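/- Let $k$ be a field and let $V,W$ be $k$-vector spaces (of arbitrary dimension) with braidings, i.e. automorphisms $c_V\in\mathrm{Aut}(V\otimes V)$, $c_W\in\mathrm{Aut}(W\otimes W)$ satisfying the braid equation $(c\otimes\mathrm{id})(\mathrm{id}\otimes c)(c\otimes\mathrm{id})=(\mathrm{id}\otimes c)(c\otimes\mathrm{id})(\mathrm{id}\otimes c)$. Let the braid group $\mathbb B_n$ act on $V^{\otimes n}$ by $\sigma_i\mapsto \mathrm{id}^{\otimes(i-1)}\otimes c_V\otimes\mathrm{id}^{\otimes(n-i-1)}$, let $s:\mathbb S_n\to\mathbb B_n$ be the section sending a reduced word $\tau_{i_1}\cdots\tau_{i_j}$ in the transpositions $\tau_i=(i,i+1)$ to $\sigma_{i_1}\cdots\sigma_{i_j}$, and for $X\subseteq\mathbb S_n$ put $\mathfrak S_X=\sum_{x\in X}s(x)\in\mathrm{End}(V^{\otimes n})$. Put $\mathfrak S^n=\mathfrak S_{\mathbb S_n}$, $\mathfrak S=\bigoplus_n\mathfrak S^n$, and $\mathfrak S_{p,q}=\mathfrak S_{X_{p,q}}$ with $$X_{p,q}=\{x\in\mathbb S_{p+q}\mid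 x^{-1}(1)<\dots<x^{-1}(p),\ x^{-1}(p+1)<\dots<x^{-1}(p+q)\}.$$ Let $A(V)=\bigoplus_n V^{\otimes n}$ be the tensor algebra, with comultiplication given on $V^{\otimes n}$ by $\sum_{p+q=n}\mathfrak S_{p,q}$, where $\mathfrak S_{p,q}:V^{\otimes n}\to V^{\otimes p}\otimes V^{\otimes q}$. Then $\ker\mathfrak S$ is a graded two-sided ideal and a coideal of $A(V)$, and $\mathfrak B(V)=A(V)/\ker\mathfrak S=\bigoplus_n V^{\otimes n}/\ker\mathfrak S^n=\bigoplus_n\mathfrak B^n(V)$ carries the induced multiplication and comultiplication $\Delta(u)=u_{(1)}\otimes u_{(2)}$ (Sweedler notation); the same applies to $W$. Let $(\,|\,):V\otimes W\to k$ be a nondegenerate bilinear form (both radicals are zero) such that $(c_V(x)\,|\,y)=(x\,|\,c_W(y))$ for all $x\in V\otimes V$, $y\in W\otimes W$, where the form on $(V\otimes V)\otimes(W\otimes W)$ is * case (a): $(v_1\otimes v_2\,|\,w_1\otimes w_2)=(v_1|w_1)(v_2|w_2)$, or * case (b): $(v_1\otimes v_2\,|\,w_1\otimes w_2)=(v_1|w_2)(v_2|w_1)$.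 Then in each of the two cases there is a unique nondegenerate bilinear form $[\,,]:\mathfrak B(V)\otimes\mathfrak B(W)\to k$ such that 1. $[1,1]=1$; 2. $[\mathfrak B^i(V),\mathfrak B^j(W)]=0$ if $i\ne j$; 3. $[v,w]=(v|w)$ for $v\in\mathfrak B^1(V)=V$, $w\in\mathfrak B^1(W)=W$; 4. $[u,zz']=[u_{(1)},z][u_{(2)},z']$ in case (a), and $[u,zz']=[u_{(1)},z'][u_{(2)},z]$ in case (b), for all $u\in\mathfrak B(V)$, $z,z'\in\mathfrak B(W)$; 5. $[uu',z]=[u,z_{(1)}][u',z_{(2)}]$ in case (a), and $[uu',z]=[u,z_{(2)}][u',z_{(1)}]$ in case (b), for all $u,u'\in\mathfrak B(V)$, $z\in\mathfrak B(W)$. Moreover, define a bilinear form on $A(V)\otimes A(W)$ by $[u,z]=0$ if $u,z$ are homogeneous of different degrees, and, for $u\in V^{\otimes n}$, $z\in W^{\otimes n}$, by $[u,z]=(\mathfrak S^nu\,|\,z)$, where $(v_1\otimes\cdots\otimes v_n\,|\,w_1\otimes\cdots\otimes w_n)$ is $\prod_i(v_i|w_i)$ in case (a) and $\prod_i(v_i|w_{n+1-i})$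 in case (b). Then the left radical of this form is $\ker(\mathfrak S:A(V)\to A(V))$, its right radical is $\ker(\mathfrak S:A(W)\to A(W))$, and the form it induces on the quotients $\mathfrak B(V)\otimes\mathfrak B(W)$ is the unique pairing above. In particular $\mathfrak B(V)$ and $\mathfrak B(W)$ are the quotients of $A(V)$ and $A(W)$ by the left and right radicals. -/

import Mathlib

open scoped TensorProduct DirectSum

namespace BraidedHopf

/-! ## The symmetric group, the braid group, and the section between them -/

section Braid

variable {n : ℕ}

/-- The first position moved by the `i`-th elementary transposition. -/
def posL (i : Fin (n - 1)) : Fin n := ⟨i, by omega⟩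

/-- The second position moved by the `i`-th elementary transposition. -/
def posR (i : Fin (n - 1)) : Fin n := ⟨i + 1, by omega⟩

/-- The elementary transposition `τ_i = (i, i+1)`. -/
def tau (i : Fin (n - 1)) : Equiv.Perm (Fin n) := Equiv.swap (posL i) (posR i)

/-- The defining relations of the Artin braid group. -/
inductive BraidRel (n : ℕ) : FreeGroup (Fin (n - 1)) → Prop
  | far (i j : Fin (n - 1)) (h : (i : ℕ) + 1 < j) :
      BraidRel n (FreeGroup.of i * FreeGroup.of j * (FreeGroup.of j * FreeGroup.of i)⁻¹)
  | near (i j : Fin (n - 1)) (h : (i : ℕ) + 1 = j) :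
      BraidRel n (FreeGroup.of i * FreeGroup.of j * FreeGroup.of i *
        (FreeGroup.of j * FreeGroup.of i * FreeGroup.of j)⁻¹)

/-- The Artin braid group on `n` strands. -/
abbrev BraidGroup (n : ℕ) : Type := PresentedGroup {r | BraidRel n r}

/-- The generator `σ_i` of the braid group. -/
def sigma (i : Fin (n - 1)) : BraidGroup n := PresentedGroup.of i

theorem sigma_far (i j : Fin (n - 1)) (h : (i : ℕ) + 1 < j) :
    sigma i * sigma j = sigma j * sigma i := by
  have := PresentedGroup.one_of_mem (rels := {r | BraidRel n r}) (BraidRel.far i j h)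
  rw [map_mul, map_inv, mul_inv_eq_one] at this
  exact this

theorem sigma_near (i j : Fin (n - 1)) (h : (i : ℕ) + 1 = j) :
    sigma i * sigma j * sigma i = sigma j * sigma i * sigma j := by
  have := PresentedGroup.one_of_mem (rels := {r | BraidRel n r}) (BraidRel.near i j h)
  rw [map_mul, map_inv, mul_inv_eq_one] at this
  exact this

/-- `l` is a word of minimal length in the elementary transpositions representing `x`. -/
def IsReducedWord (l : List (Fin (n - 1))) (x : Equiv.Perm (Fin n)) : Prop :=
  (l.map tau).prod = x ∧ ∀ l' : List (Fin (n - 1)), (l'.map tau).prod = x → l.length ≤ l'.length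

/-- Pairs of positions that `x⁻¹` puts in the wrong order. -/
def invSet (x : Equiv.Perm (Fin n)) : Finset (Fin n × Fin n) :=
  Finset.univ.filter fun p => p.1 < p.2 ∧ x.symm p.2 < x.symm p.1

/-- `i` is a left descent of `x`. -/
def Desc (i : Fin (n - 1)) (x : Equiv.Perm (Fin n)) : Prop := x.symm (posR i) < x.symm (posL i)

theorem posL_lt_posR (i : Fin (n - 1)) : posL i < posR i := by simp [posL, posR, Fin.lt_def]

theorem tau_mul_self (i : Fin (n - 1)) : tau i * tau i = 1 := Equiv.swap_mul_self _ _

theorem tau_mul_tau_mul (i : Fin (n - 1)) (x : Equiv.Perm (Fin n)) : tau i * (tau i * x) = x := by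
  rw [← mul_assoc, tau_mul_self, one_mul]

theorem tau_mul_symm_apply (i : Fin (n - 1)) (x : Equiv.Perm (Fin n)) (a : Fin n) :
    (tau i * x).symm a = x.symm (tau i a) := by
  rw [Equiv.symm_apply_eq, Equiv.Perm.mul_apply, Equiv.apply_symm_apply]
  simp [tau]

@[simp] theorem tau_posL (i : Fin (n - 1)) : tau i (posL i) = posR i := Equiv.swap_apply_left _ _
@[simp] theorem tau_posR (i : Fin (n - 1)) : tau i (posR i) = posL i := Equiv.swap_apply_right _ _

theorem tau_of_ne (i : Fin (n - 1)) (a : Fin n) (h₁ : (a : ℕ) ≠ i) (h₂ : (a : ℕ) ≠ i + 1) :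
    tau i a = a :=
  Equiv.swap_apply_of_ne_of_ne (by simpa [posL, Fin.ext_iff] using h₁)
    (by simpa [posR, Fin.ext_iff] using h₂)

theorem tau_lt_tau (i : Fin (n - 1)) (a b : Fin n) (h : a < b)
    (hne : ¬ (a = posL i ∧ b = posR i)) : tau i a < tau i b := by
  simp only [tau, Equiv.swap_apply_def]
  simp only [posL, posR, Fin.lt_def, Fin.ext_iff] at *
  split_ifs <;> simp <;> omega

theorem card_invSet_of_desc {i : Fin (n - 1)} {x : Equiv.Perm (Fin n)} (h : Desc i x) :
    (invSet x).card = (invSet (tau i * x)).card + 1 := by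
  have hmem : (posL i, posR i) ∈ invSet x := by simp [invSet, posL_lt_posR]; exact h
  have htt : ∀ a, tau i (tau i a) = a := fun a => by
    rw [← Equiv.Perm.mul_apply, tau_mul_self]; rfl
  rw [← Finset.card_erase_add_one hmem]
  congr 1
  refine Finset.card_nbij' (fun p => (tau i p.1, tau i p.2)) (fun p => (tau i p.1, tau i p.2))
    ?_ ?_ ?_ ?_
  · rintro ⟨a, b⟩ hab
    simp only [invSet, Finset.coe_erase, Finset.coe_filter, Finset.mem_univ, true_and,
      Set.mem_sdiff, Set.mem_ofPred_eq, Set.mem_singleton_iff, Prod.mk.injEq] at hab ⊢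
    refine ⟨tau_lt_tau i a b hab.1.1 hab.2, ?_⟩
    simp only [tau_mul_symm_apply, htt]
    exact hab.1.2
  · rintro ⟨a, b⟩ hab
    simp only [invSet, Finset.coe_erase, Finset.coe_filter, Finset.mem_univ, true_and,
      Set.mem_sdiff, Set.mem_ofPred_eq, Set.mem_singleton_iff, Prod.mk.injEq,
      tau_mul_symm_apply] at hab ⊢
    have hne : ¬ (a = posL i ∧ b = posR i) := by
      rintro ⟨rfl, rfl⟩
      have := hab.2
      simp only [tau_posL, tau_posR] at this
      exact absurd this (not_lt.2 h.le)
    refine ⟨⟨tau_lt_tau i a b hab.1 hne, hab.2⟩, ?_⟩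
    rintro ⟨h1, h2⟩
    have h1' := congrArg (tau i) h1
    have h2' := congrArg (tau i) h2
    rw [htt, tau_posL] at h1'
    rw [htt, tau_posR] at h2'
    subst h1' h2'
    exact absurd hab.1 (not_lt.2 (posL_lt_posR i).le)
  · rintro ⟨a, b⟩ _; simp [htt]
  · rintro ⟨a, b⟩ _; simp [htt]

theorem desc_tau_mul {i : Fin (n - 1)} {x : Equiv.Perm (Fin n)} (h : ¬ Desc i x) :
    Desc i (tau i * x) := by
  simp only [Desc, tau_mul_symm_apply, tau_posL, tau_posR, not_lt] at h ⊢
  exact lt_of_le_of_ne h fun e => (posL_lt_posR i).ne (x.symm.injective e)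

theorem card_invSet_tau_mul_le (i : Fin (n - 1)) (x : Equiv.Perm (Fin n)) :
    (invSet (tau i * x)).card ≤ (invSet x).card + 1 := by
  by_cases h : Desc i x
  · have := card_invSet_of_desc h; omega
  · have := card_invSet_of_desc (desc_tau_mul h)
    rw [tau_mul_tau_mul] at this; omega

theorem card_invSet_one : (invSet (1 : Equiv.Perm (Fin n))).card = 0 := by
  rw [Finset.card_eq_zero]
  ext ⟨a, b⟩
  simp only [invSet, Finset.mem_filter, Finset.mem_univ, true_and, Finset.notMem_empty, iff_false,
    not_and, not_lt]
  exact fun h => h.le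

theorem card_invSet_le_length (l : List (Fin (n - 1))) :
    (invSet (l.map tau).prod).card ≤ l.length := by
  induction l with
  | nil => simp [card_invSet_one]
  | cons i t ih =>
    simp only [List.map_cons, List.prod_cons, List.length_cons]
    exact (card_invSet_tau_mul_le i _).trans (by omega)

theorem eq_one_of_no_desc (x : Equiv.Perm (Fin n)) (h : ∀ i, ¬ Desc i x) : x = 1 := by
  have hm : StrictMono x.symm := by
    rcases n with _ | m
    · intro a; exact a.elim0
    · rw [Fin.strictMono_iff_lt_succ]
      intro i
      have := h i
      simp only [Desc, not_lt] at this
      refine lt_of_le_of_ne this fun e => ?_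
      have := x.symm.injective e
      simp [Fin.ext_iff] at this
  have : (⇑x.symm) = id := by
    have e := Subsingleton.elim (hm.orderIsoOfSurjective _ x.symm.surjective) (OrderIso.refl _)
    funext a
    exact congrArg (fun f : Fin n ≃o Fin n => f a) e
  ext a
  have h2 := congrFun this (x a)
  simp only [Equiv.symm_apply_apply, id] at h2
  rw [← h2]; rfl

theorem exists_word_length (x : Equiv.Perm (Fin n)) :
    ∃ l : List (Fin (n - 1)), (l.map tau).prod = x ∧ l.length = (invSet x).card := by
  induction hN : (invSet x).card generalizing x with
  | zero =>
    refine ⟨[], ?_, rfl⟩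
    refine (eq_one_of_no_desc x fun i hi => ?_).symm
    have := card_invSet_of_desc hi; omega
  | succ N ih =>
    by_cases h : ∃ i, Desc i x
    · obtain ⟨i, hi⟩ := h
      have hc := card_invSet_of_desc hi
      obtain ⟨l, hl, hlen⟩ := ih (tau i * x) (by omega)
      exact ⟨i :: l, by simp [hl, tau_mul_tau_mul], by simp [hlen]⟩
    · rw [eq_one_of_no_desc x (by simpa using h), card_invSet_one] at hN
      omega

theorem isReducedWord_iff (l : List (Fin (n - 1))) (x : Equiv.Perm (Fin n)) :
    IsReducedWord l x ↔ (l.map tau).prod = x ∧ l.length = (invSet x).card := by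
  constructor
  · rintro ⟨h, hmin⟩
    obtain ⟨l', h', hl'⟩ := exists_word_length x
    refine ⟨h, le_antisymm (hl' ▸ hmin l' h') ?_⟩
    rw [← h]; exact card_invSet_le_length l
  · rintro ⟨h, hlen⟩
    refine ⟨h, fun l' h' => ?_⟩
    rw [hlen, ← h']; exact card_invSet_le_length l'

theorem exists_isReducedWord (x : Equiv.Perm (Fin n)) : ∃ l, IsReducedWord l x := by
  obtain ⟨l, hl⟩ := exists_word_length x
  exact ⟨l, (isReducedWord_iff l x).2 hl⟩

theorem IsReducedWord.cons {i : Fin (n - 1)} {x : Equiv.Perm (Fin n)} (h : Desc i x)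
    {l : List (Fin (n - 1))} (hl : IsReducedWord l (tau i * x)) : IsReducedWord (i :: l) x := by
  rw [isReducedWord_iff] at hl ⊢
  have := card_invSet_of_desc h
  exact ⟨by simp [hl.1, tau_mul_tau_mul], by simp [hl.2]; omega⟩

theorem IsReducedWord.of_cons {i : Fin (n - 1)} {x : Equiv.Perm (Fin n)}
    {l : List (Fin (n - 1))} (hl : IsReducedWord (i :: l) x) :
    Desc i x ∧ IsReducedWord l (tau i * x) := by
  rw [isReducedWord_iff] at hl
  obtain ⟨h1, h2⟩ := hl
  simp only [List.map_cons, List.prod_cons, List.length_cons] at h1 h2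
  have h3 : (l.map tau).prod = tau i * x := by rw [← h1, tau_mul_tau_mul]
  have h4 := card_invSet_le_length l
  rw [h3] at h4
  have hd : Desc i x := by
    by_contra h
    have := card_invSet_of_desc (desc_tau_mul h)
    rw [tau_mul_tau_mul] at this; omega
  refine ⟨hd, (isReducedWord_iff _ _).2 ⟨h3, ?_⟩⟩
  have := card_invSet_of_desc hd; omega

theorem desc_far {i j : Fin (n - 1)} (hij : (i : ℕ) + 1 < j ∨ (j : ℕ) + 1 < i)
    {x : Equiv.Perm (Fin n)} (hj : Desc j x) : Desc j (tau i * x) := by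
  simp only [Desc, tau_mul_symm_apply] at hj ⊢
  rw [tau_of_ne i (posR j) (by simp [posR]; omega) (by simp [posR]; omega),
    tau_of_ne i (posL j) (by simp [posL]; omega) (by simp [posL]; omega)]
  exact hj

theorem tau_far (i j : Fin (n - 1)) (h : (i : ℕ) + 1 < j) : tau i * tau j = tau j * tau i := by
  have h1 : posL i ≠ posL j := by simp [posL, Fin.ext_iff]; omega
  have h2 : posL i ≠ posR j := by simp [posL, posR, Fin.ext_iff]; omega
  have h3 : posR i ≠ posL j := by simp [posL, posR, Fin.ext_iff]; omega
  have h4 : posR i ≠ posR j := by simp [posR, Fin.ext_iff]; omega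
  exact (Equiv.Perm.disjoint_swap_swap (by
    simp [(posL_lt_posR i).ne, (posL_lt_posR j).ne, h1, h2, h3, h4])).commute

theorem tau_near (i j : Fin (n - 1)) (h : (i : ℕ) + 1 = j) :
    tau i * tau j * tau i = tau j * tau i * tau j := by
  have e : posL j = posR i := by simp [posL, posR, Fin.ext_iff]; omega
  have h1 : posL i ≠ posR j := by simp [posL, posR, Fin.ext_iff]; omega
  have h2 := (posL_lt_posR i).ne
  have h3 := (posL_lt_posR j).ne
  rw [e] at h3
  simp only [tau, e]
  rw [Equiv.swap_mul_swap_mul_swap h2 h1, Equiv.swap_comm (posR i) (posR j),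
    Equiv.swap_comm (posL i) (posR i), Equiv.swap_mul_swap_mul_swap h3.symm h1.symm]
  exact Equiv.swap_comm _ _

theorem desc_near {i j : Fin (n - 1)} (hij : (i : ℕ) + 1 = j ∨ (j : ℕ) + 1 = i)
    {x : Equiv.Perm (Fin n)} (hi : Desc i x) (hj : Desc j x) :
    Desc j (tau i * x) ∧ Desc i (tau j * (tau i * x)) := by
  simp only [Desc, tau_mul_symm_apply] at hi hj ⊢
  rcases hij with h | h
  · have e : posL j = posR i := by simp [posL, posR, Fin.ext_iff]; omega
    have e1 : tau i (posR j) = posR j := tau_of_ne _ _ (by simp [posR]; omega) (by simp [posR]; omega)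
    have e2 : tau j (posL i) = posL i := tau_of_ne _ _ (by simp [posL]; omega) (by simp [posL]; omega)
    have e3 : tau j (posR i) = posR j := by rw [← e, tau_posL]
    rw [e2, e3, e1, e, tau_posL, tau_posR]
    rw [e] at hj
    exact ⟨hj.trans hi, hj⟩
  · have e : posR j = posL i := by simp [posL, posR, Fin.ext_iff]; omega
    have e1 : tau i (posL j) = posL j := tau_of_ne _ _ (by simp [posL]; omega) (by simp [posL]; omega)
    have e2 : tau j (posR i) = posR i := tau_of_ne _ _ (by simp [posR]; omega) (by simp [posR]; omega)
    have e3 : tau j (posL i) = posL j := by rw [← e, tau_posR]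
    rw [e2, e3, e1, e, tau_posL, tau_posR]
    rw [e] at hj
    exact ⟨hi.trans hj, hj⟩

/-- All reduced words of a permutation have the same image in the braid group. -/
theorem IsReducedWord.sigma_prod_eq {x : Equiv.Perm (Fin n)} {l l' : List (Fin (n - 1))}
    (hl : IsReducedWord l x) (hl' : IsReducedWord l' x) :
    (l.map sigma).prod = (l'.map sigma).prod := by
  induction hN : l.length using Nat.strong_induction_on generalizing x l l' with
  | _ N ih =>
  have hlen : l'.length = l.length := by
    rw [isReducedWord_iff] at hl hl'; rw [hl.2, hl'.2]
  rcases l with _ | ⟨i, t⟩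
  · rw [List.length_nil, List.length_eq_zero_iff] at hlen
    rw [hlen]
  rcases l' with _ | ⟨j, t'⟩
  · simp at hlen
  obtain ⟨hi, ht⟩ := hl.of_cons
  obtain ⟨hj, ht'⟩ := hl'.of_cons
  simp only [List.length_cons] at hN hlen
  have IH : ∀ {y : Equiv.Perm (Fin n)} {m m' : List (Fin (n - 1))}, m.length < N →
      IsReducedWord m y → IsReducedWord m' y → (m.map sigma).prod = (m'.map sigma).prod :=
    fun hm h h' => ih _ hm h h' rfl
  simp only [List.map_cons, List.prod_cons]
  have far : ∀ i j : Fin (n - 1), ((i : ℕ) + 1 < j ∨ (j : ℕ) + 1 < i) →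
      tau i * tau j = tau j * tau i ∧ sigma i * sigma j = sigma j * sigma i := by
    rintro i j (h | h)
    · exact ⟨tau_far i j h, sigma_far i j h⟩
    · exact ⟨(tau_far j i h).symm, (sigma_far j i h).symm⟩
  have near : ∀ i j : Fin (n - 1), ((i : ℕ) + 1 = j ∨ (j : ℕ) + 1 = i) →
      tau i * tau j * tau i = tau j * tau i * tau j ∧
      sigma i * sigma j * sigma i = sigma j * sigma i * sigma j := by
    rintro i j (h | h)
    · exact ⟨tau_near i j h, sigma_near i j h⟩
    · exact ⟨(tau_near j i h).symm, (sigma_near j i h).symm⟩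
  by_cases hij : i = j
  · subst hij
    rw [IH (by omega) ht ht']
  by_cases hf : (i : ℕ) + 1 < j ∨ (j : ℕ) + 1 < i
  · obtain ⟨et, es⟩ := far i j hf
    obtain ⟨m, hm⟩ := exists_isReducedWord (tau j * (tau i * x))
    have h1 : IsReducedWord (j :: m) (tau i * x) := hm.cons (desc_far hf hj)
    have h2 : IsReducedWord (i :: m) (tau j * x) :=
      IsReducedWord.cons (desc_far hf.symm hi) (by rwa [← mul_assoc, et, mul_assoc])
    rw [IH (by omega) ht h1, IH (by omega) ht' h2]
    simp only [List.map_cons, List.prod_cons, ← mul_assoc, es]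
  · have hn : (i : ℕ) + 1 = j ∨ (j : ℕ) + 1 = i := by
      have : (i : ℕ) ≠ j := fun h => hij (Fin.ext h)
      omega
    obtain ⟨et, es⟩ := near i j hn
    obtain ⟨m, hm⟩ := exists_isReducedWord (tau i * (tau j * (tau i * x)))
    have h1 : IsReducedWord (j :: i :: m) (tau i * x) :=
      (hm.cons (desc_near hn hi hj).2).cons (desc_near hn hi hj).1
    have h2 : IsReducedWord (i :: j :: m) (tau j * x) := by
      refine IsReducedWord.cons (desc_near hn.symm hj hi).1
        (IsReducedWord.cons (desc_near hn.symm hj hi).2 ?_)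
      simpa only [← mul_assoc, et] using hm
    rw [IH (by omega) ht h1, IH (by omega) ht' h2]
    simp only [List.map_cons, List.prod_cons, ← mul_assoc, es]

/-- The section `s : S_n → B_n`, sending `τ_{i₁} ⋯ τ_{i_j}` to `σ_{i₁} ⋯ σ_{i_j}` for every
word of minimal length. -/
noncomputable def braidSection (x : Equiv.Perm (Fin n)) : BraidGroup n :=
  ((exists_isReducedWord x).choose.map sigma).prod

/-- The value of the section does not depend on the reduced word. -/
theorem braidSection_eq {x : Equiv.Perm (Fin n)} {l : List (Fin (n - 1))}
    (hl : IsReducedWord l x) : braidSection x = (l.map sigma).prod :=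
  (exists_isReducedWord x).choose_spec.sigma_prod_eq hl

theorem braidSection_one : braidSection (1 : Equiv.Perm (Fin n)) = 1 :=
  braidSection_eq (l := []) ⟨rfl, fun _ _ => Nat.zero_le _⟩

theorem braidSection_desc {i : Fin (n - 1)} {x : Equiv.Perm (Fin n)} (h : Desc i x) :
    braidSection x = sigma i * braidSection (tau i * x) := by
  obtain ⟨l, hl⟩ := exists_isReducedWord (tau i * x)
  rw [braidSection_eq hl, braidSection_eq (hl.cons h), List.map_cons, List.prod_cons]

theorem tau_inv (i : Fin (n - 1)) : (tau i)⁻¹ = tau i := Equiv.swap_inv _ _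

theorem IsReducedWord.reverse {l : List (Fin (n - 1))} {x : Equiv.Perm (Fin n)}
    (hl : IsReducedWord l x) : IsReducedWord l.reverse x⁻¹ := by
  have key : ∀ m : List (Fin (n - 1)), (m.reverse.map tau).prod = ((m.map tau).prod)⁻¹ := by
    intro m
    rw [List.prod_inv_reverse, List.map_map, List.map_reverse]
    congr 2
  refine ⟨by rw [key, hl.1], fun l' h' => ?_⟩
  have := hl.2 l'.reverse (by rw [key, h', inv_inv])
  simpa using this

/-- Recursion for the section along a right descent. -/
theorem braidSection_desc_right {i : Fin (n - 1)} {x : Equiv.Perm (Fin n)} (h : Desc i x⁻¹) :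
    braidSection x = braidSection (x * tau i) * sigma i := by
  obtain ⟨l, hl⟩ := exists_isReducedWord (tau i * x⁻¹)
  have h1 := (hl.cons h).reverse
  have h2 := hl.reverse
  rw [inv_inv] at h1
  rw [mul_inv_rev, inv_inv, tau_inv] at h2
  rw [braidSection_eq h1, braidSection_eq h2]
  simp

/-! ### Shuffles -/

/-- The set `X_{p,q}` of `(p,q)`-shuffles: `x⁻¹` is increasing on the first `p` and on the
last `q` positions. -/
def shuffleX (p q : ℕ) : Set (Equiv.Perm (Fin (p + q))) :=
  {x | (∀ a b : Fin p, a < b → x⁻¹ (Fin.castAdd q a) < x⁻¹ (Fin.castAdd q b)) ∧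
    ∀ a b : Fin q, a < b → x⁻¹ (Fin.natAdd p a) < x⁻¹ (Fin.natAdd p b)}

/-- The set `Y_{p,q}` of inverses of `(p,q)`-shuffles. -/
def shuffleY (p q : ℕ) : Set (Equiv.Perm (Fin (p + q))) := {x | x⁻¹ ∈ shuffleX p q}

/-- The permutation acting by `a` on the first `p` and by `b` on the last `q` positions. -/
def blockPerm {p q : ℕ} (a : Equiv.Perm (Fin p)) (b : Equiv.Perm (Fin q)) :
    Equiv.Perm (Fin (p + q)) :=
  finSumFinEquiv.permCongr (Equiv.sumCongr a b)

section Shuffle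

variable {p q : ℕ}

@[simp] theorem blockPerm_castAdd (a : Equiv.Perm (Fin p)) (b : Equiv.Perm (Fin q)) (i : Fin p) :
    blockPerm a b (Fin.castAdd q i) = Fin.castAdd q (a i) := by
  simp [blockPerm, Equiv.permCongr_apply]

@[simp] theorem blockPerm_natAdd (a : Equiv.Perm (Fin p)) (b : Equiv.Perm (Fin q)) (i : Fin q) :
    blockPerm a b (Fin.natAdd p i) = Fin.natAdd p (b i) := by
  simp [blockPerm, Equiv.permCongr_apply]

theorem blockPerm_ext {x y : Equiv.Perm (Fin (p + q))}
    (h₁ : ∀ i, x (Fin.castAdd q i) = y (Fin.castAdd q i))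
    (h₂ : ∀ i, x (Fin.natAdd p i) = y (Fin.natAdd p i)) : x = y := by
  ext i
  refine Fin.addCases (fun i => ?_) (fun i => ?_) i
  · rw [h₁]
  · rw [h₂]

theorem blockPerm_mul (a a' : Equiv.Perm (Fin p)) (b b' : Equiv.Perm (Fin q)) :
    blockPerm a b * blockPerm a' b' = blockPerm (a * a') (b * b') :=
  blockPerm_ext (by simp) (by simp)

theorem blockPerm_one : blockPerm (1 : Equiv.Perm (Fin p)) (1 : Equiv.Perm (Fin q)) = 1 :=
  blockPerm_ext (by simp) (by simp)

theorem blockPerm_inv (a : Equiv.Perm (Fin p)) (b : Equiv.Perm (Fin q)) :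
    (blockPerm a b)⁻¹ = blockPerm a⁻¹ b⁻¹ := by
  rw [inv_eq_iff_mul_eq_one, blockPerm_mul]; simp [blockPerm_one]

/-- The index of `σ_i` acting on the first block. -/
def idxL (q : ℕ) (i : Fin (p - 1)) : Fin (p + q - 1) := ⟨i, by omega⟩

/-- The index of `σ_i` acting on the second block. -/
def idxR (p : ℕ) (i : Fin (q - 1)) : Fin (p + q - 1) := ⟨p + i, by omega⟩

theorem posL_idxL (i : Fin (p - 1)) : posL (idxL q i) = Fin.castAdd q (posL i) := rfl
theorem posR_idxL (i : Fin (p - 1)) : posR (idxL q i) = Fin.castAdd q (posR i) := rfl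
theorem posL_idxR (i : Fin (q - 1)) : posL (idxR p i) = Fin.natAdd p (posL i) := rfl
theorem posR_idxR (i : Fin (q - 1)) : posR (idxR p i) = Fin.natAdd p (posR i) := rfl

theorem tau_idxL (i : Fin (p - 1)) : tau (idxL q i) = blockPerm (tau i) 1 := by
  refine blockPerm_ext (fun a => ?_) (fun a => ?_)
  · rw [blockPerm_castAdd, tau, posL_idxL, posR_idxL, tau]
    exact (Fin.castAdd_injective p q).swap_apply _ _ _
  · rw [blockPerm_natAdd]
    refine tau_of_ne _ _ ?_ ?_ <;> simp [idxL] <;> omega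

theorem tau_idxR (i : Fin (q - 1)) : tau (idxR p i) = blockPerm 1 (tau i) := by
  refine blockPerm_ext (fun a => ?_) (fun a => ?_)
  · rw [blockPerm_castAdd]
    refine tau_of_ne _ _ ?_ ?_ <;> simp [idxR] <;> omega
  · rw [blockPerm_natAdd, tau, posL_idxR, posR_idxR, tau]
    exact (Fin.natAdd_injective q p).swap_apply _ _ _

theorem blockPerm_mul_symm (a : Equiv.Perm (Fin p)) (b : Equiv.Perm (Fin q))
    (x : Equiv.Perm (Fin (p + q))) (i : Fin (p + q)) :
    (blockPerm a b * x).symm i = x⁻¹ (blockPerm a⁻¹ b⁻¹ i) := by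
  rw [← blockPerm_inv, ← Equiv.Perm.mul_apply, ← mul_inv_rev]; rfl

theorem desc_blockPerm_left {a : Equiv.Perm (Fin p)} (b : Equiv.Perm (Fin q))
    {x : Equiv.Perm (Fin (p + q))} (hx : x ∈ shuffleX p q) {i : Fin (p - 1)} (h : Desc i a) :
    Desc (idxL q i) (blockPerm a b * x) := by
  rw [Desc, blockPerm_mul_symm, blockPerm_mul_symm, posL_idxL, posR_idxL, blockPerm_castAdd,
    blockPerm_castAdd]
  exact hx.1 _ _ h

theorem desc_blockPerm_right (a : Equiv.Perm (Fin p)) {b : Equiv.Perm (Fin q)}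
    {x : Equiv.Perm (Fin (p + q))} (hx : x ∈ shuffleX p q) {i : Fin (q - 1)} (h : Desc i b) :
    Desc (idxR p i) (blockPerm a b * x) := by
  rw [Desc, blockPerm_mul_symm, blockPerm_mul_symm, posL_idxR, posR_idxR, blockPerm_natAdd,
    blockPerm_natAdd]
  exact hx.2 _ _ h

theorem eq_one_of_monotone {m : ℕ} {N : ℕ} (f g : Fin m → Fin N) (hf : StrictMono f)
    (hg : StrictMono g) (a : Equiv.Perm (Fin m)) (h : ∀ i, f (a i) = g i) : a = 1 := by
  have hm : StrictMono a := fun i j hij => by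
    rw [← hf.lt_iff_lt, h, h]; exact hg hij
  have e := Subsingleton.elim (hm.orderIsoOfSurjective _ a.surjective) (OrderIso.refl _)
  ext i
  exact congrArg (fun f : Fin m ≃o Fin m => (f i : ℕ)) e

/-- Every permutation is uniquely a product of a block permutation and a shuffle. -/
theorem blockPerm_mul_bijective : Function.Bijective
    (fun t : (Equiv.Perm (Fin p) × Equiv.Perm (Fin q)) × shuffleX p q =>
      blockPerm t.1.1 t.1.2 * t.2.1) := by
  constructor
  · rintro ⟨⟨a, b⟩, x, hx⟩ ⟨⟨a', b'⟩, x', hx'⟩ h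
    simp only at h
    have h1 : x' = blockPerm (a'⁻¹ * a) (b'⁻¹ * b) * x := by
      rw [← blockPerm_mul, mul_assoc, h, ← blockPerm_inv, inv_mul_cancel_left]
    have h2 : ∀ i, x'⁻¹ i = x⁻¹ (blockPerm (a'⁻¹ * a)⁻¹ (b'⁻¹ * b)⁻¹ i) := by
      intro i
      rw [h1, mul_inv_rev, blockPerm_inv]; rfl
    have ha := eq_one_of_monotone (fun i => x⁻¹ (Fin.castAdd q i)) (fun i => x'⁻¹ (Fin.castAdd q i))
      (fun i j => hx.1 i j) (fun i j => hx'.1 i j) (a'⁻¹ * a)⁻¹ (fun i => by rw [h2]; simp)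
    have hb := eq_one_of_monotone (fun i => x⁻¹ (Fin.natAdd p i)) (fun i => x'⁻¹ (Fin.natAdd p i))
      (fun i j => hx.2 i j) (fun i j => hx'.2 i j) (b'⁻¹ * b)⁻¹ (fun i => by rw [h2]; simp)
    rw [inv_eq_one, inv_mul_eq_one] at ha hb
    subst ha hb
    simp only [inv_mul_cancel, blockPerm_one, one_mul] at h1
    subst h1
    rfl
  · intro w
    have inj : ∀ {m : ℕ} (f : Fin m → Fin (p + q)), Function.Injective f →
        StrictMono (f ∘ Tuple.sort f) := fun f hf =>
      (Tuple.monotone_sort f).strictMono_of_injective (hf.comp (Equiv.injective _))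
    let f : Fin p → Fin (p + q) := fun i => w⁻¹ (Fin.castAdd q i)
    let g : Fin q → Fin (p + q) := fun i => w⁻¹ (Fin.natAdd p i)
    have hf := inj f ((Equiv.injective _).comp (Fin.castAdd_injective p q))
    have hg := inj g ((Equiv.injective _).comp (Fin.natAdd_injective q p))
    refine ⟨⟨⟨Tuple.sort f, Tuple.sort g⟩, (blockPerm (Tuple.sort f) (Tuple.sort g))⁻¹ * w,
      ?_, ?_⟩, ?_⟩
    · intro i j hij
      rw [mul_inv_rev, inv_inv, Equiv.Perm.mul_apply, Equiv.Perm.mul_apply, blockPerm_castAdd,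
        blockPerm_castAdd]
      exact hf hij
    · intro i j hij
      rw [mul_inv_rev, inv_inv, Equiv.Perm.mul_apply, Equiv.Perm.mul_apply, blockPerm_natAdd,
        blockPerm_natAdd]
      exact hg hij
    · simp

end Shuffle

end Braid

/-! ## Braided vector spaces and the braid group action on tensor powers -/

section Action

variable {k V : Type*} [Field k] [AddCommGroup V] [Module k V]

/-- A braiding on a vector space `V`: an automorphism of `V ⊗ V` satisfying the braid equation
`(c ⊗ id)(id ⊗ c)(c ⊗ id) = (id ⊗ c)(c ⊗ id)(id ⊗ c)`. -/
structure Braiding (k V : Type*) [Field k] [AddCommGroup V] [Module k V] where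
  /-- The underlying automorphism. -/
  c : V ⊗[k] V ≃ₗ[k] V ⊗[k] V
  braid_eq : ∀ t : V ⊗[k] V ⊗[k] V,
    c.toLinearMap.rTensor V ((TensorProduct.assoc k V V V).symm (c.toLinearMap.lTensor V
      (TensorProduct.assoc k V V V (c.toLinearMap.rTensor V t)))) =
    (TensorProduct.assoc k V V V).symm (c.toLinearMap.lTensor V (TensorProduct.assoc k V V V
      (c.toLinearMap.rTensor V ((TensorProduct.assoc k V V V).symm (c.toLinearMap.lTensor V
        (TensorProduct.assoc k V V V t))))))

variable {n : ℕ}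

open Function in
/-- The tensor `v₀ ⊗ ⋯ ⊗ v_{n-1}` with the factors in the positions `i, i+1` replaced by a
tensor in `V ⊗ V`. -/
noncomputable def pairInsert (i : Fin (n - 1)) (v : Fin n → V) : V ⊗[k] V →ₗ[k] ⨂[k]^n V :=
  TensorProduct.lift (LinearMap.mk₂ k
    (fun x y => PiTensorProduct.tprod k (update (update v (posL i) x) (posR i) y))
    (fun x x' y => by
      simp only [update_comm (posL_lt_posR i).ne, MultilinearMap.map_update_add])
    (fun r x y => by
      simp only [update_comm (posL_lt_posR i).ne, MultilinearMap.map_update_smul])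
    (fun x y y' => by simp only [MultilinearMap.map_update_add])
    (fun r x y => by simp only [MultilinearMap.map_update_smul]))

open Function in
theorem pairInsert_tmul (i : Fin (n - 1)) (v : Fin n → V) (x y : V) :
    pairInsert i v (x ⊗ₜ[k] y) =
      PiTensorProduct.tprod k (update (update v (posL i) x) (posR i) y) := rfl

open Function in
theorem pairInsert_update_left (i : Fin (n - 1)) (v : Fin n → V) (x : V) :
    pairInsert (k := k) i (update v (posL i) x) = pairInsert i v := by
  ext a b
  simp [pairInsert_tmul]

open Function in
theorem pairInsert_update_right (i : Fin (n - 1)) (v : Fin n → V) (x : V) :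
    pairInsert (k := k) i (update v (posR i) x) = pairInsert i v := by
  ext a b
  simp [pairInsert_tmul, update_comm (posL_lt_posR i).ne]

open Function in
theorem pairInsert_update_of_ne (i : Fin (n - 1)) (v : Fin n → V) {m : Fin n} (h₁ : m ≠ posL i)
    (h₂ : m ≠ posR i) (x a b : V) :
    pairInsert (k := k) i (update v m x) (a ⊗ₜ b) =
      PiTensorProduct.tprod k (update (update (update v (posL i) a) (posR i) b) m x) := by
  rw [pairInsert_tmul, update_comm h₁, update_comm h₂]

open Function in
/-- The operator `id ⊗ ⋯ ⊗ f ⊗ ⋯ ⊗ id` on `V^{⊗ n}`, with `f` acting on the tensor factors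
`i, i+1`. -/
noncomputable def localOp (f : V ⊗[k] V →ₗ[k] V ⊗[k] V) (i : Fin (n - 1)) :
    ⨂[k]^n V →ₗ[k] ⨂[k]^n V :=
  PiTensorProduct.lift
    { toFun := fun v => pairInsert i v (f (v (posL i) ⊗ₜ[k] v (posR i)))
      map_update_add' := by
        intro inst v m x y
        have e : inst = instDecidableEqFin n := Subsingleton.elim _ _
        subst e
        have hne := (posL_lt_posR i).ne
        by_cases h₁ : m = posL i
        · subst h₁
          simp [pairInsert_update_left, update_of_ne hne.symm, TensorProduct.add_tmul]
        by_cases h₂ : m = posR i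
        · subst h₂
          simp [pairInsert_update_right, update_of_ne hne, TensorProduct.tmul_add]
        simp only [update_of_ne (Ne.symm h₁), update_of_ne (Ne.symm h₂), ← LinearMap.add_apply]
        congr 1
        ext a b
        simp only [TensorProduct.AlgebraTensorModule.curry_apply, LinearMap.restrictScalars_self,
          TensorProduct.curry_apply, LinearMap.add_apply, pairInsert_update_of_ne i v h₁ h₂,
          MultilinearMap.map_update_add]
      map_update_smul' := by
        intro inst v m r x
        have e : inst = instDecidableEqFin n := Subsingleton.elim _ _
        subst e
        have hne := (posL_lt_posR i).ne
        by_cases h₁ : m = posL i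
        · subst h₁
          simp [pairInsert_update_left, update_of_ne hne.symm, ← TensorProduct.smul_tmul']
        by_cases h₂ : m = posR i
        · subst h₂
          simp [pairInsert_update_right, update_of_ne hne]
        simp only [update_of_ne (Ne.symm h₁), update_of_ne (Ne.symm h₂), ← LinearMap.smul_apply]
        congr 1
        ext a b
        simp only [TensorProduct.AlgebraTensorModule.curry_apply, LinearMap.restrictScalars_self,
          TensorProduct.curry_apply, LinearMap.smul_apply, pairInsert_update_of_ne i v h₁ h₂,
          MultilinearMap.map_update_smul] }

theorem localOp_tprod (f : V ⊗[k] V →ₗ[k] V ⊗[k] V) (i : Fin (n - 1)) (v : Fin n → V) :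
    localOp f i (PiTensorProduct.tprod k v) = pairInsert i v (f (v (posL i) ⊗ₜ[k] v (posR i))) :=
  PiTensorProduct.lift.tprod v

theorem localOp_pairInsert (f : V ⊗[k] V →ₗ[k] V ⊗[k] V) (i : Fin (n - 1)) (v : Fin n → V)
    (t : V ⊗[k] V) : localOp f i (pairInsert i v t) = pairInsert i v (f t) := by
  induction t with
  | zero => simp
  | add x y hx hy => simp only [map_add, hx, hy]
  | tmul x y =>
    rw [pairInsert_tmul, localOp_tprod, pairInsert_update_right, pairInsert_update_left,
      Function.update_self, Function.update_of_ne (posL_lt_posR i).ne, Function.update_self]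

theorem localOp_comp (f g : V ⊗[k] V →ₗ[k] V ⊗[k] V) (i : Fin (n - 1)) (t : ⨂[k]^n V) :
    localOp f i (localOp g i t) = localOp (f ∘ₗ g) i t := by
  induction t using PiTensorProduct.induction_on with
  | smul_tprod r v => simp only [map_smul, localOp_tprod, localOp_pairInsert, LinearMap.comp_apply]
  | add x y hx hy => simp only [map_add, hx, hy]

theorem localOp_id (i : Fin (n - 1)) (t : ⨂[k]^n V) :
    localOp (LinearMap.id : V ⊗[k] V →ₗ[k] V ⊗[k] V) i t = t := by
  induction t using PiTensorProduct.induction_on with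
  | smul_tprod r v =>
    simp only [map_smul, localOp_tprod, LinearMap.id_apply, pairInsert_tmul]
    simp
  | add x y hx hy => simp only [map_add, hx, hy]

open Function in
/-- Insertion of two tensors of `V ⊗ V` at two disjoint pairs of neighbouring positions. -/
noncomputable def pairInsertTwo (i j : Fin (n - 1)) (h : (i : ℕ) + 1 < j) (v : Fin n → V) :
    V ⊗[k] V →ₗ[k] V ⊗[k] V →ₗ[k] ⨂[k]^n V :=
  have h1 : posL j ≠ posL i := by simp [posL, Fin.ext_iff]; omega
  have h2 : posR j ≠ posL i := by simp [posL, posR, Fin.ext_iff]; omega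
  have h3 : posL j ≠ posR i := by simp [posL, posR, Fin.ext_iff]; omega
  have h4 : posR j ≠ posR i := by simp [posR, Fin.ext_iff]; omega
  TensorProduct.lift (LinearMap.mk₂ k
    (fun x y => pairInsert i (update (update v (posL j) x) (posR j) y))
    (fun x x' y => by
      ext a b
      simp [update_comm (posL_lt_posR j).ne, pairInsert_update_of_ne _ _ h1 h3])
    (fun r x y => by
      ext a b
      simp [update_comm (posL_lt_posR j).ne, pairInsert_update_of_ne _ _ h1 h3])
    (fun x y y' => by
      ext a b
      simp [pairInsert_update_of_ne _ _ h2 h4])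
    (fun r x y => by
      ext a b
      simp [pairInsert_update_of_ne _ _ h2 h4]))

open Function in
theorem pairInsertTwo_tmul (i j : Fin (n - 1)) (h : (i : ℕ) + 1 < j) (v : Fin n → V) (x y : V) :
    pairInsertTwo (k := k) i j h v (x ⊗ₜ y) =
      pairInsert i (update (update v (posL j) x) (posR j) y) := rfl

open Function in
theorem localOp_far (f : V ⊗[k] V →ₗ[k] V ⊗[k] V) (i j : Fin (n - 1)) (h : (i : ℕ) + 1 < j)
    (t : ⨂[k]^n V) : localOp f i (localOp f j t) = localOp f j (localOp f i t) := by
  have h1 : posL j ≠ posL i := by simp [posL, Fin.ext_iff]; omega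
  have h2 : posR j ≠ posL i := by simp [posL, posR, Fin.ext_iff]; omega
  have h3 : posL j ≠ posR i := by simp [posL, posR, Fin.ext_iff]; omega
  have h4 : posR j ≠ posR i := by simp [posR, Fin.ext_iff]; omega
  induction t using PiTensorProduct.induction_on with
  | add x y hx hy => simp only [map_add, hx, hy]
  | smul_tprod r v =>
    simp only [map_smul, localOp_tprod]
    congr 1
    have l1 : ∀ t, localOp f i (pairInsert j v t) =
        pairInsertTwo i j h v t (f (v (posL i) ⊗ₜ[k] v (posR i))) := by
      intro t
      induction t with
      | zero => simp
      | add x y hx hy => simp only [map_add, hx, hy, LinearMap.add_apply]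
      | tmul x y =>
        rw [pairInsert_tmul, localOp_tprod, pairInsertTwo_tmul, update_of_ne h2.symm,
          update_of_ne h1.symm, update_of_ne h4.symm, update_of_ne h3.symm]
    have l2 : ∀ (a b : V) (t : V ⊗[k] V), pairInsert j (update (update v (posL i) a) (posR i) b) t =
        pairInsertTwo i j h v t (a ⊗ₜ b) := by
      intro a b t
      induction t with
      | zero => simp
      | add x y hx hy => simp only [map_add, hx, hy, LinearMap.add_apply]
      | tmul x y =>
        rw [pairInsertTwo_tmul, pairInsert_update_of_ne _ _ h2 h4, pairInsert_tmul,
          update_comm h1, update_comm h3]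
    have l3 : ∀ s, localOp f j (pairInsert i v s) =
        pairInsertTwo i j h v (f (v (posL j) ⊗ₜ[k] v (posR j))) s := by
      intro s
      induction s with
      | zero => simp
      | add x y hx hy => simp only [map_add, hx, hy]
      | tmul x y =>
        rw [pairInsert_tmul, localOp_tprod, l2, update_of_ne h4, update_of_ne h2,
          update_of_ne h3, update_of_ne h1]
    rw [l1, l3]

open Function in
/-- Insertion of a tensor of `V ⊗ V ⊗ V` at three neighbouring positions. -/
noncomputable def tripInsert (i j : Fin (n - 1)) (h : (i : ℕ) + 1 = j) (v : Fin n → V) :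
    V ⊗[k] V ⊗[k] V →ₗ[k] ⨂[k]^n V :=
  have h1 : posR j ≠ posL i := by simp [posL, posR, Fin.ext_iff]; omega
  have h2 : posR j ≠ posR i := by simp [posR, Fin.ext_iff]; omega
  TensorProduct.lift (LinearMap.flip
    { toFun := fun z => pairInsert i (update v (posR j) z)
      map_add' := fun z z' => by
        ext a b
        simp [pairInsert_update_of_ne _ _ h1 h2]
      map_smul' := fun r z => by
        ext a b
        simp [pairInsert_update_of_ne _ _ h1 h2] })

open Function in
theorem tripInsert_tmul (i j : Fin (n - 1)) (h : (i : ℕ) + 1 = j) (v : Fin n → V)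
    (t : V ⊗[k] V) (z : V) :
    tripInsert (k := k) i j h v (t ⊗ₜ z) = pairInsert i (update v (posR j) z) t := rfl

open Function in
theorem localOp_tripInsert_left (f : V ⊗[k] V →ₗ[k] V ⊗[k] V) (i j : Fin (n - 1))
    (h : (i : ℕ) + 1 = j) (v : Fin n → V) (t : V ⊗[k] V ⊗[k] V) :
    localOp f i (tripInsert i j h v t) = tripInsert i j h v (f.rTensor V t) := by
  induction t with
  | zero => simp
  | add x y hx hy => simp only [map_add, hx, hy]
  | tmul x y => rw [LinearMap.rTensor_tmul, tripInsert_tmul, tripInsert_tmul, localOp_pairInsert]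

open Function in
theorem tripInsert_assoc_symm (i j : Fin (n - 1)) (h : (i : ℕ) + 1 = j) (v : Fin n → V)
    (x : V) (t : V ⊗[k] V) :
    tripInsert i j h v ((TensorProduct.assoc k V V V).symm (x ⊗ₜ t)) =
      pairInsert j (update v (posL i) x) t := by
  have e : posL j = posR i := by simp [posL, posR, Fin.ext_iff]; omega
  have h1 : posR j ≠ posL i := by simp [posL, posR, Fin.ext_iff]; omega
  have h2 : posR j ≠ posR i := by simp [posR, Fin.ext_iff]; omega
  induction t with
  | zero => simp
  | add x y hx hy => simp only [map_add, hx, hy, TensorProduct.tmul_add]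
  | tmul y z =>
    rw [TensorProduct.assoc_symm_tmul, tripInsert_tmul, pairInsert_update_of_ne _ _ h1 h2,
      pairInsert_tmul, e]

open Function in
theorem localOp_tripInsert_right (f : V ⊗[k] V →ₗ[k] V ⊗[k] V) (i j : Fin (n - 1))
    (h : (i : ℕ) + 1 = j) (v : Fin n → V) (t : V ⊗[k] V ⊗[k] V) :
    localOp f j (tripInsert i j h v t) = tripInsert i j h v ((TensorProduct.assoc k V V V).symm
      (f.lTensor V (TensorProduct.assoc k V V V t))) := by
  obtain ⟨t, rfl⟩ := (TensorProduct.assoc k V V V).symm.surjective t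
  rw [LinearEquiv.apply_symm_apply]
  induction t with
  | zero => simp
  | add x y hx hy => simp only [map_add, hx, hy]
  | tmul x t => rw [LinearMap.lTensor_tmul, tripInsert_assoc_symm, tripInsert_assoc_symm,
      localOp_pairInsert]

theorem Braiding.localOp_near (c : Braiding k V) (i j : Fin (n - 1)) (h : (i : ℕ) + 1 = j)
    (t : ⨂[k]^n V) :
    localOp c.c.toLinearMap i (localOp c.c.toLinearMap j (localOp c.c.toLinearMap i t)) =
    localOp c.c.toLinearMap j (localOp c.c.toLinearMap i (localOp c.c.toLinearMap j t)) := by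
  induction t using PiTensorProduct.induction_on with
  | add x y hx hy => simp only [map_add, hx, hy]
  | smul_tprod r v =>
    have e : PiTensorProduct.tprod k v =
        tripInsert i j h v (v (posL i) ⊗ₜ[k] v (posR i) ⊗ₜ[k] v (posR j)) := by
      rw [tripInsert_tmul, Function.update_eq_self, pairInsert_tmul, Function.update_eq_self,
        Function.update_eq_self]
    rw [e]
    simp only [map_smul, localOp_tripInsert_left, localOp_tripInsert_right]
    rw [c.braid_eq]

/-- The operator `σ_i` on `V^{⊗ n}` as an automorphism. -/
noncomputable def Braiding.localEquiv (c : Braiding k V) (n : ℕ) (i : Fin (n - 1)) :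
    ⨂[k]^n V ≃ₗ[k] ⨂[k]^n V :=
  LinearEquiv.ofLinearMap (localOp c.c.toLinearMap i) (localOp c.c.symm.toLinearMap i)
    (by ext1; ext v; simp [localOp_comp, localOp_id])
    (by ext1; ext v; simp [localOp_comp, localOp_id])

theorem Braiding.localEquiv_apply (c : Braiding k V) (n : ℕ) (i : Fin (n - 1)) (t : ⨂[k]^n V) :
    c.localEquiv n i t = localOp c.c.toLinearMap i t := rfl

/-- The action of the braid group on `V^{⊗ n}`, with `σ_i` acting as
`id ⊗ ⋯ ⊗ c ⊗ ⋯ ⊗ id` on the factors `i, i+1`. -/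
noncomputable def Braiding.action (c : Braiding k V) (n : ℕ) :
    BraidGroup n →* (⨂[k]^n V ≃ₗ[k] ⨂[k]^n V) :=
  PresentedGroup.toGroup (f := c.localEquiv n) (by
    rintro _ (⟨i, j, h⟩ | ⟨i, j, h⟩)
    · rw [map_mul, map_inv, mul_inv_eq_one]
      ext1 t
      simpa [Braiding.localEquiv_apply] using localOp_far _ i j h t
    · rw [map_mul, map_inv, mul_inv_eq_one]
      ext1 t
      simpa [Braiding.localEquiv_apply] using c.localOp_near i j h t)

theorem Braiding.action_sigma (c : Braiding k V) (i : Fin (n - 1)) (t : ⨂[k]^n V) :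
    c.action n (sigma i) t = localOp c.c.toLinearMap i t := by
  rw [Braiding.action, sigma, PresentedGroup.toGroup.of, Braiding.localEquiv_apply]

end Action

/-! ## The quantum symmetrizers -/

section Symmetrizer

variable {k V : Type*} [Field k] [AddCommGroup V] [Module k V] (c : Braiding k V)

open Classical in
/-- The operator `𝔖_X = ∑_{x ∈ X} s(x)` on `V^{⊗ n}`, for a set `X` of permutations. -/
noncomputable def Braiding.symOp {n : ℕ} (X : Set (Equiv.Perm (Fin n))) :
    ⨂[k]^n V →ₗ[k] ⨂[k]^n V :=
  ∑ x ∈ Finset.univ.filter (· ∈ X), (c.action n (braidSection x)).toLinearMap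

/-- The quantum symmetrizer `𝔖^n`, the sum over the whole symmetric group. -/
noncomputable def Braiding.sym (n : ℕ) : ⨂[k]^n V →ₗ[k] ⨂[k]^n V :=
  c.symOp (Set.univ : Set (Equiv.Perm (Fin n)))

/-- The component `Δ_{p,q} = 𝔖_{p,q}` of the comultiplication of the braided tensor algebra. -/
noncomputable def Braiding.comulPart (p q : ℕ) :
    ⨂[k]^(p + q) V →ₗ[k] ⨂[k]^p V ⊗[k] ⨂[k]^q V :=
  TensorPower.mulEquiv.symm.toLinearMap ∘ₗ c.symOp (shuffleX p q)

/-- The component `m_{p,q} = 𝔗_{p,q}` of the quantum shuffle multiplication. -/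
noncomputable def Braiding.shufflePart (p q : ℕ) :
    ⨂[k]^p V ⊗[k] ⨂[k]^q V →ₗ[k] ⨂[k]^(p + q) V :=
  c.symOp (shuffleY p q) ∘ₗ TensorPower.mulEquiv.toLinearMap

theorem Braiding.symOp_apply {n : ℕ} (X : Set (Equiv.Perm (Fin n))) [Fintype X] (t : ⨂[k]^n V) :
    c.symOp X t = ∑ x : X, c.action n (braidSection (x : Equiv.Perm (Fin n))) t := by
  classical
  rw [Braiding.symOp, LinearMap.sum_apply]
  exact (Finset.sum_subtype _ (by simp) _)

theorem Braiding.sym_apply (n : ℕ) (t : ⨂[k]^n V) :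
    c.sym n t = ∑ x : Equiv.Perm (Fin n), c.action n (braidSection x) t := by
  simp [Braiding.sym, Braiding.symOp, LinearMap.sum_apply]

variable {p q : ℕ}

theorem append_update_left {α : Type*} (v : Fin p → α) (w : Fin q → α) (i : Fin p) (x : α) :
    Fin.append (Function.update v i x) w = Function.update (Fin.append v w) (Fin.castAdd q i) x := by
  funext j
  refine Fin.addCases (fun j => ?_) (fun j => ?_) j
  · by_cases h : j = i
    · subst h; simp
    · simp [h, Function.update_of_ne]
  · rw [Function.update_of_ne] <;> simp [Fin.ext_iff]; omega

theorem append_update_right {α : Type*} (v : Fin p → α) (w : Fin q → α) (i : Fin q) (x : α) :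
    Fin.append v (Function.update w i x) = Function.update (Fin.append v w) (Fin.natAdd p i) x := by
  funext j
  refine Fin.addCases (fun j => ?_) (fun j => ?_) j
  · rw [Function.update_of_ne] <;> simp [Fin.ext_iff]; omega
  · by_cases h : j = i
    · subst h; simp
    · simp [h, Function.update_of_ne]

theorem mulEquiv_tprod (v : Fin p → V) (w : Fin q → V) :
    TensorPower.mulEquiv (PiTensorProduct.tprod k v ⊗ₜ[k] PiTensorProduct.tprod k w) =
      PiTensorProduct.tprod k (Fin.append v w) :=
  TensorPower.tprod_mul_tprod k v w

theorem localOp_mulEquiv_left (f : V ⊗[k] V →ₗ[k] V ⊗[k] V) (i : Fin (p - 1))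
    (a : ⨂[k]^p V) (b : ⨂[k]^q V) :
    localOp f (idxL q i) (TensorPower.mulEquiv (a ⊗ₜ[k] b)) =
      TensorPower.mulEquiv (localOp f i a ⊗ₜ[k] b) := by
  induction b using PiTensorProduct.induction_on with
  | add x y hx hy => simp only [map_add, TensorProduct.tmul_add, hx, hy]
  | smul_tprod r w =>
  induction a using PiTensorProduct.induction_on with
  | add x y hx hy => simp only [map_add, TensorProduct.add_tmul, hx, hy]
  | smul_tprod r' v =>
    simp only [TensorProduct.tmul_smul, ← TensorProduct.smul_tmul', map_smul, mulEquiv_tprod,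
      localOp_tprod, posL_idxL, posR_idxL, Fin.append_left]
    congr 2
    generalize f (v (posL i) ⊗ₜ[k] v (posR i)) = t
    induction t with
    | zero => simp
    | add x y hx hy => simp only [map_add, TensorProduct.add_tmul, hx, hy]
    | tmul x y =>
      rw [pairInsert_tmul, pairInsert_tmul, mulEquiv_tprod, append_update_left, append_update_left,
        posL_idxL, posR_idxL]

theorem localOp_mulEquiv_right (f : V ⊗[k] V →ₗ[k] V ⊗[k] V) (i : Fin (q - 1))
    (a : ⨂[k]^p V) (b : ⨂[k]^q V) :
    localOp f (idxR p i) (TensorPower.mulEquiv (a ⊗ₜ[k] b)) =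
      TensorPower.mulEquiv (a ⊗ₜ[k] localOp f i b) := by
  induction b using PiTensorProduct.induction_on with
  | add x y hx hy => simp only [map_add, TensorProduct.tmul_add, hx, hy]
  | smul_tprod r w =>
  induction a using PiTensorProduct.induction_on with
  | add x y hx hy => simp only [map_add, TensorProduct.add_tmul, hx, hy]
  | smul_tprod r' v =>
    simp only [TensorProduct.tmul_smul, ← TensorProduct.smul_tmul', map_smul, mulEquiv_tprod,
      localOp_tprod, posL_idxR, posR_idxR, Fin.append_right]
    congr 2
    generalize f (w (posL i) ⊗ₜ[k] w (posR i)) = t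
    induction t with
    | zero => simp
    | add x y hx hy => simp only [map_add, TensorProduct.tmul_add, hx, hy]
    | tmul x y =>
      rw [pairInsert_tmul, pairInsert_tmul, mulEquiv_tprod, append_update_right,
        append_update_right, posL_idxR, posR_idxR]

/-- The action of a pair of permutations on `V^{⊗ p} ⊗ V^{⊗ q}`. -/
noncomputable def Braiding.blockOp (a : Equiv.Perm (Fin p)) (b : Equiv.Perm (Fin q)) :
    ⨂[k]^p V ⊗[k] ⨂[k]^q V →ₗ[k] ⨂[k]^p V ⊗[k] ⨂[k]^q V :=
  TensorProduct.map (c.action p (braidSection a)).toLinearMap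
    (c.action q (braidSection b)).toLinearMap

theorem card_invSet_mul_tau (a : Equiv.Perm (Fin p)) :
    (invSet a = ∅ → a = 1) ∧ (a ≠ 1 → ∃ i, Desc i a) := by
  have h : a ≠ 1 → ∃ i, Desc i a := fun h => by
    by_contra hn
    exact h (eq_one_of_no_desc a (by simpa using hn))
  refine ⟨fun he => ?_, h⟩
  by_contra hn
  obtain ⟨i, hi⟩ := h hn
  have := card_invSet_of_desc hi
  rw [he] at this; simp at this

theorem Braiding.action_blockPerm_mul (a : Equiv.Perm (Fin p)) (b : Equiv.Perm (Fin q))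
    {x : Equiv.Perm (Fin (p + q))} (hx : x ∈ shuffleX p q) (t : ⨂[k]^(p + q) V) :
    c.action (p + q) (braidSection (blockPerm a b * x)) t =
      TensorPower.mulEquiv (c.blockOp a b (TensorPower.mulEquiv.symm
        (c.action (p + q) (braidSection x) t))) := by
  induction hN : (invSet a).card + (invSet b).card using Nat.strong_induction_on
    generalizing a b with
  | _ N ih =>
  by_cases ha : a = 1
  · by_cases hb : b = 1
    · subst ha hb
      have : c.blockOp (1 : Equiv.Perm (Fin p)) (1 : Equiv.Perm (Fin q)) = LinearMap.id := by
        rw [Braiding.blockOp, braidSection_one, braidSection_one, map_one, map_one]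
        exact TensorProduct.map_id
      rw [this, blockPerm_one, one_mul]; simp
    · obtain ⟨i, hi⟩ := (card_invSet_mul_tau b).2 hb
      have hc := card_invSet_of_desc hi
      rw [braidSection_desc (desc_blockPerm_right a hx hi), map_mul, LinearEquiv.mul_apply,
        tau_idxR, ← mul_assoc, blockPerm_mul, one_mul, ih _ (by omega) _ _ rfl, c.action_sigma]
      generalize TensorPower.mulEquiv.symm (c.action (p + q) (braidSection x) t) = u
      induction u with
      | zero => simp
      | add x y hx hy => simp only [map_add, hx, hy]
      | tmul x y =>
        rw [Braiding.blockOp, Braiding.blockOp, TensorProduct.map_tmul, TensorProduct.map_tmul,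
          localOp_mulEquiv_right, ← c.action_sigma, braidSection_desc hi, map_mul]
        rfl
  · obtain ⟨i, hi⟩ := (card_invSet_mul_tau a).2 ha
    have hc := card_invSet_of_desc hi
    rw [braidSection_desc (desc_blockPerm_left b hx hi), map_mul, LinearEquiv.mul_apply,
      tau_idxL, ← mul_assoc, blockPerm_mul, one_mul, ih _ (by omega) _ _ rfl, c.action_sigma]
    generalize TensorPower.mulEquiv.symm (c.action (p + q) (braidSection x) t) = u
    induction u with
    | zero => simp
    | add x y hx hy => simp only [map_add, hx, hy]
    | tmul x y =>
      rw [Braiding.blockOp, Braiding.blockOp, TensorProduct.map_tmul, TensorProduct.map_tmul,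
        localOp_mulEquiv_left, ← c.action_sigma, braidSection_desc hi, map_mul]
      rfl

theorem card_invSet_inv (a : Equiv.Perm (Fin p)) : (invSet a⁻¹).card = (invSet a).card := by
  obtain ⟨l, hl⟩ := exists_isReducedWord a
  have h1 := ((isReducedWord_iff _ _).1 hl).2
  have h2 := ((isReducedWord_iff _ _).1 hl.reverse).2
  rw [← h1, ← h2, List.length_reverse]

theorem Braiding.action_mul_blockPerm (a : Equiv.Perm (Fin p)) (b : Equiv.Perm (Fin q))
    {y : Equiv.Perm (Fin (p + q))} (hy : y ∈ shuffleY p q) (u : ⨂[k]^p V ⊗[k] ⨂[k]^q V) :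
    c.action (p + q) (braidSection (y * blockPerm a b)) (TensorPower.mulEquiv u) =
      c.action (p + q) (braidSection y) (TensorPower.mulEquiv (c.blockOp a b u)) := by
  induction hN : (invSet a⁻¹).card + (invSet b⁻¹).card using Nat.strong_induction_on
    generalizing a b u with
  | _ N ih =>
  have hinv : (y * blockPerm a b)⁻¹ = blockPerm a⁻¹ b⁻¹ * y⁻¹ := by
    rw [mul_inv_rev, blockPerm_inv]
  by_cases ha : a⁻¹ = 1
  · by_cases hb : b⁻¹ = 1
    · rw [inv_eq_one] at ha hb
      subst ha hb
      have : c.blockOp (1 : Equiv.Perm (Fin p)) (1 : Equiv.Perm (Fin q)) = LinearMap.id := by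
        rw [Braiding.blockOp, braidSection_one, braidSection_one, map_one, map_one]
        exact TensorProduct.map_id
      rw [this, blockPerm_one, mul_one]; simp
    · obtain ⟨i, hi⟩ := (card_invSet_mul_tau b⁻¹).2 hb
      have hc := card_invSet_of_desc hi
      have hd : Desc (idxR p i) (y * blockPerm a b)⁻¹ := by
        rw [hinv]; exact desc_blockPerm_right _ hy hi
      induction u with
      | zero => simp
      | add x y hx hy => simp only [map_add, hx, hy]
      | tmul x z =>
        rw [braidSection_desc_right hd, map_mul, LinearEquiv.mul_apply, c.action_sigma,
          localOp_mulEquiv_right, tau_idxR, mul_assoc, blockPerm_mul, mul_one,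
          ih _ (by rw [mul_inv_rev, tau_inv]; omega) _ _ _ rfl]
        rw [Braiding.blockOp, Braiding.blockOp, TensorProduct.map_tmul, TensorProduct.map_tmul,
          ← c.action_sigma, braidSection_desc_right hi, map_mul]
        rfl
  · obtain ⟨i, hi⟩ := (card_invSet_mul_tau a⁻¹).2 ha
    have hc := card_invSet_of_desc hi
    have hd : Desc (idxL q i) (y * blockPerm a b)⁻¹ := by
      rw [hinv]; exact desc_blockPerm_left _ hy hi
    induction u with
    | zero => simp
    | add x y hx hy => simp only [map_add, hx, hy]
    | tmul x z =>
      rw [braidSection_desc_right hd, map_mul, LinearEquiv.mul_apply, c.action_sigma,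
        localOp_mulEquiv_left, tau_idxL, mul_assoc, blockPerm_mul, mul_one,
        ih _ (by rw [mul_inv_rev, tau_inv]; omega) _ _ _ rfl]
      rw [Braiding.blockOp, Braiding.blockOp, TensorProduct.map_tmul, TensorProduct.map_tmul,
        ← c.action_sigma, braidSection_desc_right hi, map_mul]
      rfl

theorem Braiding.map_sym_sym (u : ⨂[k]^p V ⊗[k] ⨂[k]^q V) :
    TensorProduct.map (c.sym p) (c.sym q) u =
      ∑ ab : Equiv.Perm (Fin p) × Equiv.Perm (Fin q), c.blockOp ab.1 ab.2 u := by
  induction u with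
  | zero => simp
  | add x y hx hy => simp only [map_add, hx, hy, Finset.sum_add_distrib]
  | tmul x y =>
    rw [TensorProduct.map_tmul, c.sym_apply, c.sym_apply, TensorProduct.sum_tmul,
      Fintype.sum_prod_type]
    refine Finset.sum_congr rfl fun a _ => ?_
    rw [TensorProduct.tmul_sum]
    rfl

/-- `𝔖^{p+q} = (𝔖^p ⊗ 𝔖^q) 𝔖_{p,q}`. -/
theorem Braiding.sym_add (t : ⨂[k]^(p + q) V) :
    TensorPower.mulEquiv.symm (c.sym (p + q) t) =
      TensorProduct.map (c.sym p) (c.sym q) (c.comulPart p q t) := by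
  classical
  rw [LinearEquiv.symm_apply_eq, c.map_sym_sym, c.sym_apply,
    ← Function.Bijective.sum_comp blockPerm_mul_bijective, Fintype.sum_prod_type, map_sum]
  refine Finset.sum_congr rfl fun ab _ => ?_
  rw [Braiding.comulPart, LinearMap.comp_apply, c.symOp_apply]
  simp only [map_sum, LinearEquiv.coe_coe]
  exact Finset.sum_congr rfl fun x _ => c.action_blockPerm_mul _ _ x.2 t

/-- `𝔖^{p+q} = 𝔗_{p,q} (𝔖^p ⊗ 𝔖^q)`. -/
theorem Braiding.sym_mulEquiv (u : ⨂[k]^p V ⊗[k] ⨂[k]^q V) :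
    c.sym (p + q) (TensorPower.mulEquiv u) =
      c.shufflePart p q (TensorProduct.map (c.sym p) (c.sym q) u) := by
  classical
  have e : ∑ w : Equiv.Perm (Fin (p + q)), c.action (p + q) (braidSection w)
      (TensorPower.mulEquiv u) = ∑ w : Equiv.Perm (Fin (p + q)),
        c.action (p + q) (braidSection w⁻¹) (TensorPower.mulEquiv u) :=
    (Equiv.sum_comp (Equiv.inv _) _).symm
  rw [c.map_sym_sym, c.sym_apply, e,
    ← Function.Bijective.sum_comp blockPerm_mul_bijective, Fintype.sum_prod_type, map_sum,
    ← Equiv.sum_comp (Equiv.inv _)]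
  refine Finset.sum_congr rfl fun ab _ => ?_
  rw [Braiding.shufflePart, LinearMap.comp_apply, c.symOp_apply]
  let e' : shuffleX p q ≃ shuffleY p q := (Equiv.inv _).subtypeEquiv fun x => by
    simp [shuffleY]
  rw [← Equiv.sum_comp e']
  refine Finset.sum_congr rfl fun x _ => ?_
  have hx : (x : Equiv.Perm (Fin (p + q)))⁻¹ ∈ shuffleY p q := by simp [shuffleY]
  have := c.action_mul_blockPerm ab.1 ab.2 hx u
  refine Eq.trans ?_ this
  simp only [Equiv.inv_apply, Prod.fst_inv, Prod.snd_inv, mul_inv_rev, blockPerm_inv, inv_inv]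

end Symmetrizer

/-! ## The braided tensor algebra `A(V)`, the map `𝔖` and the algebra `𝔅(V)` -/

section TobaDef

variable {k V : Type*} [Field k] [AddCommGroup V] [Module k V]

/-- The tensor powers form a graded ring. -/
noncomputable instance tensorPowerGRing : DirectSum.GRing (fun n : ℕ => ⨂[k]^n V) :=
  { TensorPower.gsemiring with
    intCast := fun z => TensorPower.algebraMap₀ (z : k)
    intCast_ofNat := fun m => congrArg TensorPower.algebraMap₀ (Int.cast_natCast m)
    intCast_negSucc_ofNat := fun m => by
      rw [Int.cast_negSucc, map_neg]; rfl }

variable (k V) in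
/-- The tensor algebra `T(V) = ⨁ₙ V^{⊗ n}`, with its usual multiplication. It is the algebra
underlying the braided bialgebra `A(V)`. -/
abbrev TensorAlg : Type _ := ⨁ n : ℕ, ⨂[k]^n V

variable (k V) in
/-- The inclusion of `V^{⊗ n}` in the tensor algebra. -/
noncomputable abbrev incl (n : ℕ) : ⨂[k]^n V →ₗ[k] TensorAlg k V :=
  DirectSum.lof k ℕ (fun n => ⨂[k]^n V) n

variable (c : Braiding k V)

/-- The graded map `𝔖 = ⨁ₙ 𝔖^n`. -/
noncomputable def Braiding.symTotal : TensorAlg k V →ₗ[k] TensorAlg k V :=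
  DirectSum.lmap fun n => c.sym n

variable (k V) in
/-- The graded piece of degree `n` of the tensor algebra regarded in degree `m`: the identity for
`n = m` (and zero otherwise). -/
noncomputable def regrade (n m : ℕ) : ⨂[k]^n V →ₗ[k] ⨂[k]^m V :=
  DirectSum.component k ℕ (fun n => ⨂[k]^n V) m ∘ₗ incl k V n

/-- The comultiplication of `A(V)`, given on `V^{⊗ n}` by the sum over `p + q = n` of the
components `Δ_{p,q} = 𝔖_{p,q} : V^{⊗ n} → V^{⊗ p} ⊗ V^{⊗ q}`. -/
noncomputable def Braiding.comul : TensorAlg k V →ₗ[k] TensorAlg k V ⊗[k] TensorAlg k V :=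
  DirectSum.toModule k ℕ _ fun n => ∑ p ∈ Finset.HasAntidiagonal.antidiagonal n,
    TensorProduct.map (incl k V p.1) (incl k V p.2) ∘ₗ c.comulPart p.1 p.2 ∘ₗ
      regrade k V n (p.1 + p.2)

theorem regrade_self (n : ℕ) (t : ⨂[k]^n V) : regrade k V n n t = t := by
  simp [regrade]

variable (k V) in
/-- The deconcatenation comultiplication. -/
noncomputable def deconcat : TensorAlg k V →ₗ[k] TensorAlg k V ⊗[k] TensorAlg k V :=
  DirectSum.toModule k ℕ _ fun n => ∑ p ∈ Finset.HasAntidiagonal.antidiagonal n,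
    TensorProduct.map (incl k V p.1) (incl k V p.2) ∘ₗ TensorPower.mulEquiv.symm.toLinearMap ∘ₗ
      regrade k V n (p.1 + p.2)

theorem Braiding.symTotal_incl (n : ℕ) (t : ⨂[k]^n V) :
    c.symTotal (incl k V n t) = incl k V n (c.sym n t) := DirectSum.lmap_lof _ _ _

/-- `𝔖` is a morphism of coalgebras from `A(V)` to the deconcatenation coalgebra. -/
theorem Braiding.deconcat_symTotal (u : TensorAlg k V) :
    deconcat k V (c.symTotal u) = TensorProduct.map c.symTotal c.symTotal (c.comul u) := by
  induction u using DirectSum.induction_on with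
  | zero => simp
  | add x y hx hy => simp only [map_add, hx, hy]
  | of n t =>
    change deconcat k V (c.symTotal (incl k V n t)) =
      TensorProduct.map c.symTotal c.symTotal (c.comul (incl k V n t))
    rw [c.symTotal_incl, deconcat, Braiding.comul, DirectSum.toModule_lof, DirectSum.toModule_lof,
      LinearMap.sum_apply, LinearMap.sum_apply, map_sum]
    refine Finset.sum_congr rfl ?_
    rintro ⟨p, q⟩ hpq
    obtain rfl := Finset.HasAntidiagonal.mem_antidiagonal.1 hpq
    simp only [LinearMap.comp_apply, regrade_self, LinearEquiv.coe_coe, c.sym_add]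
    generalize c.comulPart p q t = w
    induction w with
    | zero => simp
    | add x y hx hy => simp only [map_add, hx, hy]
    | tmul x y => simp only [TensorProduct.map_tmul, c.symTotal_incl]

theorem incl_mul_incl (p q : ℕ) (a : ⨂[k]^p V) (b : ⨂[k]^q V) :
    incl k V p a * incl k V q b = incl k V (p + q) (TensorPower.mulEquiv (a ⊗ₜ[k] b)) :=
  DirectSum.of_mul_of _ _

/-- The quantum shuffle multiplication. -/
noncomputable def Braiding.shuffleMul :
    TensorAlg k V →ₗ[k] TensorAlg k V →ₗ[k] TensorAlg k V :=
  DirectSum.toModule k ℕ _ fun p => LinearMap.flip (DirectSum.toModule k ℕ _ fun q =>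
    LinearMap.flip (TensorProduct.curry (incl k V (p + q) ∘ₗ c.shufflePart p q)))

/-- `𝔖` is multiplicative from the tensor algebra to the quantum shuffle algebra. -/
theorem Braiding.symTotal_mul (u v : TensorAlg k V) :
    c.symTotal (u * v) = c.shuffleMul (c.symTotal u) (c.symTotal v) := by
  induction u using DirectSum.induction_on with
  | zero => simp
  | add x y hx hy => simp only [map_add, add_mul, hx, hy, LinearMap.add_apply]
  | of p a =>
  induction v using DirectSum.induction_on with
  | zero => simp
  | add x y hx hy => simp only [map_add, mul_add, hx, hy]
  | of q b =>
    change c.symTotal (incl k V p a * incl k V q b) =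
      c.shuffleMul (c.symTotal (incl k V p a)) (c.symTotal (incl k V q b))
    rw [incl_mul_incl, c.symTotal_incl, c.symTotal_incl, c.symTotal_incl, c.sym_mulEquiv,
      Braiding.shuffleMul, DirectSum.toModule_lof, LinearMap.flip_apply, DirectSum.toModule_lof]
    rfl

/-- The kernel of `𝔖`, a two-sided ideal of the tensor algebra. -/
noncomputable def Braiding.symKer : Ideal (TensorAlg k V) :=
  { LinearMap.ker c.symTotal with
    smul_mem' := fun x y hy => by
      have hy' : c.symTotal y = 0 := hy
      change c.symTotal (x * y) = 0
      rw [c.symTotal_mul, hy', map_zero] }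

theorem Braiding.mem_symKer (u : TensorAlg k V) : u ∈ c.symKer ↔ c.symTotal u = 0 := Iff.rfl

instance Braiding.symKer_isTwoSided : c.symKer.IsTwoSided :=
  ⟨fun {u} v hu => by
    rw [Braiding.mem_symKer] at hu ⊢
    rw [c.symTotal_mul, hu, map_zero, LinearMap.zero_apply]⟩

/-- The algebra `𝔅(V) = A(V) / ker 𝔖` of a braided vector space. -/
abbrev Braiding.Toba : Type _ := TensorAlg k V ⧸ c.symKer

/-- The projection `A(V) → 𝔅(V)`. -/
noncomputable def Braiding.proj : TensorAlg k V →ₐ[k] c.Toba := Ideal.Quotient.mkₐ k c.symKer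

theorem Braiding.proj_surjective : Function.Surjective c.proj := Ideal.Quotient.mk_surjective

theorem Braiding.proj_eq_zero_iff (u : TensorAlg k V) : c.proj u = 0 ↔ c.symTotal u = 0 :=
  Ideal.Quotient.eq_zero_iff_mem

/-- The component `𝔅^n(V)` of degree `n`. -/
noncomputable def Braiding.degree (n : ℕ) : Submodule k c.Toba :=
  LinearMap.range (c.proj.toLinearMap ∘ₗ incl k V n)

theorem exists_comp_eq_of_ker_le {M N P : Type*} [AddCommGroup M] [Module k M] [AddCommGroup N]
    [Module k N] [AddCommGroup P] [Module k P] (f : M →ₗ[k] N) (h : M →ₗ[k] P)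
    (hf : LinearMap.ker f ≤ LinearMap.ker h) : ∃ g : N →ₗ[k] P, g ∘ₗ f = h := by
  obtain ⟨r, hr⟩ := f.rangeRestrict.exists_rightInverse_of_surjective f.range_rangeRestrict
  obtain ⟨g, hg⟩ := (h ∘ₗ r).exists_extend
  refine ⟨g, LinearMap.ext fun u => ?_⟩
  have h1 : g (f u) = h (r (f.rangeRestrict u)) := LinearMap.congr_fun hg (f.rangeRestrict u)
  have h2 : f (r (f.rangeRestrict u)) = f u :=
    congrArg Subtype.val (LinearMap.congr_fun hr (f.rangeRestrict u))
  rw [LinearMap.comp_apply, h1, ← sub_eq_zero, ← map_sub]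
  exact hf (by rw [LinearMap.mem_ker, map_sub, h2, sub_self])

theorem Braiding.exists_proj_eq :
    ∃ g : TensorAlg k V →ₗ[k] c.Toba, g ∘ₗ c.symTotal = c.proj.toLinearMap :=
  exists_comp_eq_of_ker_le _ _ fun u hu => (c.proj_eq_zero_iff u).2 hu

/-- `ker 𝔖` is a coideal. -/
theorem Braiding.ker_proj_le :
    LinearMap.ker c.proj.toLinearMap ≤
      LinearMap.ker (TensorProduct.map c.proj.toLinearMap c.proj.toLinearMap ∘ₗ c.comul) := by
  intro u hu
  obtain ⟨g, hg⟩ := c.exists_proj_eq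
  have hu' : c.symTotal u = 0 := (c.proj_eq_zero_iff u).1 hu
  rw [LinearMap.mem_ker, LinearMap.comp_apply, ← hg, TensorProduct.map_comp, LinearMap.comp_apply,
    ← c.deconcat_symTotal, hu', map_zero, map_zero]

/-- The comultiplication of `𝔅(V)`, induced from the one of `A(V)`. -/
noncomputable def Braiding.tobaComul : c.Toba →ₗ[k] c.Toba ⊗[k] c.Toba :=
  (LinearMap.ker c.proj.toLinearMap).liftQ
      (TensorProduct.map c.proj.toLinearMap c.proj.toLinearMap ∘ₗ c.comul) c.ker_proj_le ∘ₗ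
    (c.proj.toLinearMap.quotKerEquivOfSurjective c.proj_surjective).symm.toLinearMap

theorem Braiding.tobaComul_proj (u : TensorAlg k V) :
    c.tobaComul (c.proj u) =
      TensorProduct.map c.proj.toLinearMap c.proj.toLinearMap (c.comul u) := by
  have : (c.proj.toLinearMap.quotKerEquivOfSurjective c.proj_surjective).symm (c.proj u) =
      (LinearMap.ker c.proj.toLinearMap).mkQ u := by
    rw [LinearEquiv.symm_apply_eq]; rfl
  rw [Braiding.tobaComul, LinearMap.comp_apply, LinearEquiv.coe_coe, this]
  rfl

end TobaDef

/-! ## Bilinear forms -/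

section Forms

variable {k V W : Type*} [Field k] [AddCommGroup V] [Module k V] [AddCommGroup W] [Module k W]

/-- The form `(x ⊗ x' | y ⊗ y') = (x | y) (x' | y')` on `V ⊗ V` and `W ⊗ W`. -/
noncomputable def tensorSquare (β : V →ₗ[k] W →ₗ[k] k) : V ⊗[k] V →ₗ[k] W ⊗[k] W →ₗ[k] k :=
  TensorProduct.dualDistrib k W W ∘ₗ TensorProduct.map β β

theorem tensorSquare_tmul (β : V →ₗ[k] W →ₗ[k] k) (x x' : V) (y y' : W) :
    tensorSquare β (x ⊗ₜ x') (y ⊗ₜ y') = β x y * β x' y' := rfl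

/-- Case (a): the braidings are adjoint for `(x ⊗ x' | y ⊗ y') = (x | y) (x' | y')`. -/
def CaseA (cV : Braiding k V) (cW : Braiding k W) (β : V →ₗ[k] W →ₗ[k] k) : Prop :=
  ∀ (x : V ⊗[k] V) (y : W ⊗[k] W), tensorSquare β (cV.c x) y = tensorSquare β x (cW.c y)

/-- Case (b): the braidings are adjoint for `(x ⊗ x' | y ⊗ y') = (x | y') (x' | y)`. -/
def CaseB (cV : Braiding k V) (cW : Braiding k W) (β : V →ₗ[k] W →ₗ[k] k) : Prop :=
  ∀ (x : V ⊗[k] V) (y : W ⊗[k] W),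
    tensorSquare β (cV.c x) (TensorProduct.comm k W W y) =
      tensorSquare β x (TensorProduct.comm k W W (cW.c y))

/-- The form `(v₁ ⊗ ⋯ ⊗ vₙ | w₁ ⊗ ⋯ ⊗ wₙ)_> = ∏ᵢ (vᵢ | wᵢ)`. -/
noncomputable def formGt (β : V →ₗ[k] W →ₗ[k] k) (n : ℕ) : ⨂[k]^n V →ₗ[k] ⨂[k]^n W →ₗ[k] k :=
  PiTensorProduct.dualDistrib ∘ₗ PiTensorProduct.map fun _ => β

theorem formGt_tprod (β : V →ₗ[k] W →ₗ[k] k) (n : ℕ) (v : Fin n → V) (w : Fin n → W) :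
    formGt β n (PiTensorProduct.tprod k v) (PiTensorProduct.tprod k w) = ∏ i, β (v i) (w i) := by
  simp [formGt]

/-- The form `(v₁ ⊗ ⋯ ⊗ vₙ | w₁ ⊗ ⋯ ⊗ wₙ)_< = ∏ᵢ (vᵢ | w_{n+1-i})`. -/
noncomputable def formLt (β : V →ₗ[k] W →ₗ[k] k) (n : ℕ) : ⨂[k]^n V →ₗ[k] ⨂[k]^n W →ₗ[k] k :=
  (formGt β n).compl₂ (PiTensorProduct.reindex k (fun _ => W) Fin.revPerm).toLinearMap

theorem formLt_tprod (β : V →ₗ[k] W →ₗ[k] k) (n : ℕ) (v : Fin n → V) (w : Fin n → W) :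
    formLt β n (PiTensorProduct.tprod k v) (PiTensorProduct.tprod k w) =
      ∏ i, β (v i) (w (Fin.rev i)) := by
  rw [formLt, LinearMap.compl₂_apply, LinearEquiv.coe_coe, PiTensorProduct.reindex_tprod,
    formGt_tprod]
  rfl

/-- The form `[u, z]` on `A(V) × A(W)` attached to forms `(|)` on the tensor powers: it is
`(𝔖ⁿ u | z)` for `u`, `z` of the same degree `n`, and zero for different degrees. -/
noncomputable def totalForm (cV : Braiding k V) (f : ∀ n : ℕ, ⨂[k]^n V →ₗ[k] ⨂[k]^n W →ₗ[k] k) :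
    TensorAlg k V →ₗ[k] TensorAlg k W →ₗ[k] k :=
  DirectSum.toModule k ℕ _ fun n =>
    (f n ∘ₗ cV.sym n).compl₂ (DirectSum.component k ℕ (fun n => ⨂[k]^n W) n)

theorem totalForm_same (cV : Braiding k V) (f : ∀ n : ℕ, ⨂[k]^n V →ₗ[k] ⨂[k]^n W →ₗ[k] k)
    (n : ℕ) (u : ⨂[k]^n V) (z : ⨂[k]^n W) :
    totalForm cV f (incl k V n u) (incl k W n z) = f n (cV.sym n u) z := by
  rw [totalForm, DirectSum.toModule_lof, LinearMap.compl₂_apply, DirectSum.component.lof_self]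
  rfl

theorem totalForm_of_ne (cV : Braiding k V) (f : ∀ n : ℕ, ⨂[k]^n V →ₗ[k] ⨂[k]^n W →ₗ[k] k)
    {m n : ℕ} (h : m ≠ n) (u : ⨂[k]^m V) (z : ⨂[k]^n W) :
    totalForm cV f (incl k V m u) (incl k W n z) = 0 := by
  rw [totalForm, DirectSum.toModule_lof, LinearMap.compl₂_apply, DirectSum.component.of,
    dif_neg h.symm, map_zero]

/-- The inclusion `V → 𝔅(V)` onto the component of degree one. -/
noncomputable def Braiding.deg1 (cV : Braiding k V) : V →ₗ[k] cV.Toba :=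
  cV.proj.toLinearMap ∘ₗ incl k V 1 ∘ₗ
    (PiTensorProduct.subsingletonEquiv (R := k) (s := fun _ : Fin 1 => V) 0).symm.toLinearMap

end Forms

/-! ## Pairings between `𝔅(V)` and `𝔅(W)` -/

section Pairing

variable {k V W : Type*} [Field k] [AddCommGroup V] [Module k V] [AddCommGroup W] [Module k W]

/-- The part of the requirements on a pairing `𝔅(V) ⊗ 𝔅(W) → k` that is common to both cases. -/
structure IsGradedPairing (cV : Braiding k V) (cW : Braiding k W) (β : V →ₗ[k] W →ₗ[k] k)
    (P : cV.Toba →ₗ[k] cW.Toba →ₗ[k] k) : Prop where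
  nondegenerate : P.Nondegenerate
  one_one : P 1 1 = 1
  graded : ∀ i j : ℕ, i ≠ j → ∀ x ∈ cV.degree i, ∀ y ∈ cW.degree j, P x y = 0
  deg_one : ∀ (v : V) (w : W), P (cV.deg1 v) (cW.deg1 w) = β v w

/-- The pairings in case (a): `[u, z z'] = [u₁, z] [u₂, z']` and `[u u', z] = [u, z₁] [u', z₂]`. -/
structure IsPairingA (cV : Braiding k V) (cW : Braiding k W) (β : V →ₗ[k] W →ₗ[k] k)
    (P : cV.Toba →ₗ[k] cW.Toba →ₗ[k] k) : Prop extends IsGradedPairing cV cW β P where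
  apply_mul : ∀ (u : cV.Toba) (z z' : cW.Toba),
    P u (z * z') = tensorSquare P (cV.tobaComul u) (z ⊗ₜ[k] z')
  mul_apply : ∀ (u u' : cV.Toba) (z : cW.Toba),
    P (u * u') z = tensorSquare P (u ⊗ₜ[k] u') (cW.tobaComul z)

/-- The pairings in case (b): `[u, z z'] = [u₁, z'] [u₂, z]` and `[u u', z] = [u, z₂] [u', z₁]`. -/
structure IsPairingB (cV : Braiding k V) (cW : Braiding k W) (β : V →ₗ[k] W →ₗ[k] k)
    (P : cV.Toba →ₗ[k] cW.Toba →ₗ[k] k) : Prop extends IsGradedPairing cV cW β P where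
  apply_mul : ∀ (u : cV.Toba) (z z' : cW.Toba),
    P u (z * z') = tensorSquare P (cV.tobaComul u) (z' ⊗ₜ[k] z)
  mul_apply : ∀ (u u' : cV.Toba) (z : cW.Toba),
    P (u * u') z = tensorSquare P (u' ⊗ₜ[k] u) (cW.tobaComul z)

end Pairing

end BraidedHopf

/-!
Let `𝔖ⁿ = cV.sym n`. The pairing is `[u, z] = (𝔖ⁿ u | z)`, where `( | )` is `formGt β` or `formLt β`
on the tensor powers. Concatenation in `W` is dual under `( | )` to deconcatenation in `V`, and `𝔖`
is a morphism of coalgebras from the braided comultiplication to deconcatenation; this gives the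
formula for `[u, z z']`. Since `c_V` and `c_W` are adjoint and `s(x⁻¹)` is the reversal of `s(x)`,
the symmetrizers are adjoint as well, so the roles of `V` and `W` can be exchanged, which gives the
formula for `[u u', z]`. In case (b) the form reverses the tensor factors, which turns `σ_i` into
`σ_{n-i}`; this only permutes the terms of `𝔖ⁿ`.

The forms on the tensor powers are nondegenerate, so the radicals of `[ , ]` are the kernels of the
symmetrizers. Uniqueness holds because `𝔅(W)` is generated in degree one.
-/

namespace BraidedHopf

section SeparatingForms

variable {R M M' N N' : Type*} [CommRing R] [AddCommGroup M] [Module R M] [AddCommGroup M']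
  [Module R M'] [AddCommGroup N] [Module R N] [AddCommGroup N'] [Module R N']

theorem eq_zero_of_forall_rTensor_flip_eq_zero [Module.Free R M'] {B : M →ₗ[R] N →ₗ[R] R}
    (hB : B.SeparatingLeft) {t : M ⊗[R] M'} (ht : ∀ y, (B.flip y).rTensor M' t = 0) : t = 0 := by
  classical
  let b := Module.Free.chooseBasis R M'
  refine (LinearEquiv.map_eq_zero_iff (TensorProduct.equivFinsuppOfBasisRight b)).1
    (Finsupp.ext fun i => ?_)
  rw [TensorProduct.equivFinsuppOfBasisRight_apply, Finsupp.zero_apply]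
  refine hB _ fun y => ?_
  have interchange : B.flip y ∘ₗ (TensorProduct.rid R M).toLinearMap ∘ₗ (b.coord i).lTensor M =
      b.coord i ∘ₗ (TensorProduct.lid R M').toLinearMap ∘ₗ (B.flip y).rTensor M' :=
    TensorProduct.ext' fun x x' => by simp [mul_comm]
  simpa [ht y] using LinearMap.congr_fun interchange t

theorem separatingLeft_dualDistrib_map [Module.Free R M'] {B : M →ₗ[R] N →ₗ[R] R}
    {B' : M' →ₗ[R] N' →ₗ[R] R} (hB : B.SeparatingLeft) (hB' : B'.SeparatingLeft) :
    (TensorProduct.dualDistrib R N N' ∘ₗ TensorProduct.map B B').SeparatingLeft := by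
  intro t ht
  refine eq_zero_of_forall_rTensor_flip_eq_zero hB fun y => ?_
  refine (LinearEquiv.map_eq_zero_iff (TensorProduct.lid R M')).1 (hB' _ fun y' => ?_)
  have contract : B'.flip y' ∘ₗ (TensorProduct.lid R M').toLinearMap ∘ₗ (B.flip y).rTensor M' =
      (TensorProduct.dualDistrib R N N' ∘ₗ TensorProduct.map B B').flip (y ⊗ₜ y') :=
    TensorProduct.ext' fun x x' => by simp
  exact (LinearMap.congr_fun contract t).trans (ht _)

variable {P : Type*} [AddCommGroup P] [Module R P] {π : M →ₗ[R] M'} {π' : N →ₗ[R] N'}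
  {T : M →ₗ[R] N →ₗ[R] P} {S : M' →ₗ[R] N' →ₗ[R] P}

theorem exists_bilinear_descent (hπ : Function.Surjective π) (hπ' : Function.Surjective π')
    (hT : LinearMap.ker π ≤ LinearMap.ker T) (hT' : LinearMap.ker π' ≤ LinearMap.ker T.flip) :
    ∃ S : M' →ₗ[R] N' →ₗ[R] P, ∀ x y, S (π x) (π' y) = T x y := by
  refine ⟨(LinearMap.liftQ₂ _ _ T hT hT').compl₁₂ (π.quotKerEquivOfSurjective hπ).symm.toLinearMap
    (π'.quotKerEquivOfSurjective hπ').symm.toLinearMap, fun x y => ?_⟩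
  simp

theorem separatingLeft_of_descent (hπ : Function.Surjective π)
    (hS : ∀ x y, S (π x) (π' y) = T x y) (hT : LinearMap.ker T ≤ LinearMap.ker π) :
    S.SeparatingLeft := by
  intro x' hx'
  obtain ⟨x, rfl⟩ := hπ x'
  exact hT (LinearMap.ext fun y => (hS x y).symm.trans (hx' _))

theorem exists_nondegenerate_descent (hπ : Function.Surjective π) (hπ' : Function.Surjective π')
    (hT : LinearMap.ker T = LinearMap.ker π) (hT' : LinearMap.ker T.flip = LinearMap.ker π') :
    ∃ S : M' →ₗ[R] N' →ₗ[R] P, S.Nondegenerate ∧ ∀ x y, S (π x) (π' y) = T x y := by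
  obtain ⟨S, hS⟩ := exists_bilinear_descent hπ hπ' hT.ge hT'.ge
  exact ⟨S, ⟨separatingLeft_of_descent hπ hS hT.le, LinearMap.flip_separatingLeft.1 <|
    separatingLeft_of_descent hπ' (fun y x => hS x y) hT'.le⟩, hS⟩

end SeparatingForms

section TensorPowerForms

variable {k V W : Type*} [Field k] [AddCommGroup V] [Module k V] [AddCommGroup W] [Module k W]
  (β : V →ₗ[k] W →ₗ[k] k)

theorem formGt_flip (n : ℕ) : (formGt β n).flip = formGt β.flip n := by
  ext w v
  simp [formGt_tprod]

theorem formLt_flip (n : ℕ) : (formLt β n).flip = formLt β.flip n := by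
  ext w v
  simpa [formLt_tprod] using Fintype.prod_equiv Fin.revPerm _ _ fun i => by simp

theorem formGt_comp_mulEquiv (p q : ℕ) :
    (formGt β (p + q)).compl₁₂ TensorPower.mulEquiv.toLinearMap TensorPower.mulEquiv.toLinearMap =
      TensorProduct.dualDistrib k _ _ ∘ₗ TensorProduct.map (formGt β p) (formGt β q) := by
  ext v v' w w'
  simp [mulEquiv_tprod, formGt_tprod, Fin.prod_univ_add]

theorem formGt_mulEquiv {p q : ℕ} (x : ⨂[k]^p V) (y : ⨂[k]^q V) (z : ⨂[k]^p W) (z' : ⨂[k]^q W) :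
    formGt β (p + q) (TensorPower.mulEquiv (x ⊗ₜ y)) (TensorPower.mulEquiv (z ⊗ₜ z')) =
      formGt β p x z * formGt β q y z' :=
  LinearMap.congr_fun₂ (formGt_comp_mulEquiv β p q) (x ⊗ₜ y) (z ⊗ₜ z')

theorem reindex_revPerm_mulEquiv {p q : ℕ} (z : ⨂[k]^p W) (z' : ⨂[k]^q W) :
    PiTensorProduct.reindex k (fun _ => W) Fin.revPerm
        (TensorPower.cast k W (add_comm q p) (TensorPower.mulEquiv (z' ⊗ₜ z))) =
      TensorPower.mulEquiv (PiTensorProduct.reindex k (fun _ => W) Fin.revPerm z ⊗ₜ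
        PiTensorProduct.reindex k (fun _ => W) Fin.revPerm z') := by
  suffices h : ((PiTensorProduct.reindex k (fun _ => W) Fin.revPerm).toLinearMap ∘ₗ
      (TensorPower.cast k W (add_comm q p)).toLinearMap ∘ₗ TensorPower.mulEquiv.toLinearMap ∘ₗ
      (TensorProduct.comm k _ _).toLinearMap) = TensorPower.mulEquiv.toLinearMap ∘ₗ
      TensorProduct.map (PiTensorProduct.reindex k (fun _ => W) Fin.revPerm).toLinearMap
        (PiTensorProduct.reindex k (fun _ => W) Fin.revPerm).toLinearMap from
    LinearMap.congr_fun h (z ⊗ₜ z')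
  ext w w'
  have append_rev (i : Fin (p + q)) : Fin.append w' w (Fin.cast (add_comm p q) i.rev) =
      Fin.append (fun i => w (Fin.revPerm i)) (fun i => w' (Fin.revPerm i)) i := by
    rw [Fin.cast_rev, Fin.append_rev]
    rfl
  simp [mulEquiv_tprod, PiTensorProduct.reindex_tprod, TensorPower.cast_tprod, append_rev]

theorem formLt_mulEquiv {p q : ℕ} (x : ⨂[k]^p V) (y : ⨂[k]^q V) (z : ⨂[k]^p W) (z' : ⨂[k]^q W) :
    formLt β (p + q) (TensorPower.mulEquiv (x ⊗ₜ y))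
        (TensorPower.cast k W (add_comm q p) (TensorPower.mulEquiv (z' ⊗ₜ z))) =
      formLt β p x z * formLt β q y z' := by
  simp only [formLt, LinearMap.compl₂_apply, LinearEquiv.coe_coe]
  rw [reindex_revPerm_mulEquiv, formGt_mulEquiv]

variable {β}

theorem formGt_zero_separatingLeft : (formGt β 0).SeparatingLeft := by
  intro x hx
  obtain ⟨r, rfl⟩ := (PiTensorProduct.isEmptyEquiv (Fin 0)).symm.surjective x
  have hr : r = 0 := by simpa [formGt_tprod] using hx (PiTensorProduct.tprod k isEmptyElim)
  rw [hr, map_zero]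

theorem formGt_one_separatingLeft (hβ : β.SeparatingLeft) : (formGt β 1).SeparatingLeft := by
  intro x hx
  obtain ⟨v, rfl⟩ :=
    (PiTensorProduct.subsingletonEquiv (R := k) (s := fun _ : Fin 1 => V) 0).symm.surjective x
  refine (LinearEquiv.map_eq_zero_iff _).2 (hβ v fun w => ?_)
  simpa [formGt_tprod] using hx (PiTensorProduct.tprod k fun _ => w)

theorem formGt_separatingLeft (hβ : β.SeparatingLeft) (n : ℕ) : (formGt β n).SeparatingLeft := by
  induction n with
  | zero => exact formGt_zero_separatingLeft
  | succ n ih =>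
    refine separatingLeft_of_descent TensorPower.mulEquiv.surjective
      (T := TensorProduct.dualDistrib k _ _ ∘ₗ TensorProduct.map (formGt β n) (formGt β 1))
      (LinearMap.congr_fun₂ (formGt_comp_mulEquiv β n 1)) ?_
    rw [LinearMap.separatingLeft_iff_ker_eq_bot.1
      (separatingLeft_dualDistrib_map ih (formGt_one_separatingLeft hβ))]
    exact bot_le

theorem formLt_separatingLeft (hβ : β.SeparatingLeft) (n : ℕ) : (formLt β n).SeparatingLeft := by
  intro x hx
  refine formGt_separatingLeft hβ n x fun y => ?_
  obtain ⟨z, rfl⟩ := (PiTensorProduct.reindex k (fun _ => W) (Fin.revPerm (n := n))).surjective y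
  exact hx z

end TensorPowerForms

section Adjoints

variable {R M N P : Type*} [CommRing R] [AddCommGroup M] [Module R M] [AddCommGroup N] [Module R N]
  [AddCommGroup P] [Module R P] {B : M →ₗ[R] N →ₗ[R] P}

/-- The endomorphisms `f` of `M` and `g` of `N` are adjoint for the pairing `B` of `M` and `N`.
This is the notion `LinearMap.IsAdjointPair` would express if it allowed two different modules in
one pairing. -/
def IsAdjointFor (B : M →ₗ[R] N →ₗ[R] P) (f : Module.End R M) (g : Module.End R N) : Prop :=
  ∀ x y, B (f x) y = B x (g y)

theorem IsAdjointFor.mul {f f' : Module.End R M} {g g' : Module.End R N} (h : IsAdjointFor B f g)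
    (h' : IsAdjointFor B f' g') : IsAdjointFor B (f * f') (g' * g) :=
  fun x y => (h (f' x) y).trans (h' x (g y))

theorem IsAdjointFor.sum {ι : Type*} {s : Finset ι} {f : ι → Module.End R M}
    {g : ι → Module.End R N} (h : ∀ i ∈ s, IsAdjointFor B (f i) (g i)) :
    IsAdjointFor B (∑ i ∈ s, f i) (∑ i ∈ s, g i) := fun x y => by
  simpa only [LinearMap.sum_apply, map_sum] using Finset.sum_congr rfl fun i hi => h i hi x y

end Adjoints

section LocalAdjoints

variable {k V W : Type*} [Field k] [AddCommGroup V] [Module k V] [AddCommGroup W] [Module k W]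
  {β : V →ₗ[k] W →ₗ[k] k} {n : ℕ}

theorem formGt_pairInsert (β : V →ₗ[k] W →ₗ[k] k) (i : Fin (n - 1)) (v : Fin n → V)
    (w : Fin n → W) :
    (formGt β n).compl₁₂ (pairInsert i v) (pairInsert i w) =
      (∏ j ∈ {posL i, posR i}ᶜ, β (v j) (w j)) • tensorSquare β := by
  classical
  ext a b a' b'
  have hne := (posL_lt_posR i).ne
  suffices ∏ j, β (Function.update (Function.update v (posL i) a) (posR i) b j)
      (Function.update (Function.update w (posL i) a') (posR i) b' j) =
      (∏ j ∈ {posL i, posR i}ᶜ, β (v j) (w j)) * (β a a' * β b b') by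
    simpa [pairInsert_tmul, formGt_tprod, tensorSquare_tmul] using this
  rw [← Finset.prod_compl_mul_prod {posL i, posR i}, Finset.prod_pair hne]
  congr 1
  · refine Finset.prod_congr rfl fun j hj => ?_
    simp only [Finset.mem_compl, Finset.mem_insert, Finset.mem_singleton, not_or] at hj
    simp only [Function.update_of_ne hj.1, Function.update_of_ne hj.2]
  · simp only [Function.update_of_ne hne, Function.update_self]

theorem tprod_eq_pairInsert (i : Fin (n - 1)) (v : Fin n → V) :
    PiTensorProduct.tprod k v = pairInsert i v (v (posL i) ⊗ₜ v (posR i)) := by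
  rw [pairInsert_tmul, Function.update_eq_self, Function.update_eq_self]

theorem isAdjointFor_localOp {f : V ⊗[k] V →ₗ[k] V ⊗[k] V} {g : W ⊗[k] W →ₗ[k] W ⊗[k] W}
    (h : IsAdjointFor (tensorSquare β) f g) (i : Fin (n - 1)) :
    IsAdjointFor (formGt β n) (localOp f i) (localOp g i) := by
  suffices e : formGt β n ∘ₗ localOp f i = (formGt β n).compl₂ (localOp g i) from
    LinearMap.congr_fun₂ e
  ext v w
  have formGt_pairInsert_apply (t s) : formGt β n (pairInsert i v t) (pairInsert i w s) =
      (∏ j ∈ {posL i, posR i}ᶜ, β (v j) (w j)) • tensorSquare β t s :=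
    LinearMap.congr_fun₂ (formGt_pairInsert β i v w) t s
  simp only [LinearMap.compMultilinearMap_apply, LinearMap.comp_apply, LinearMap.compl₂_apply,
    tprod_eq_pairInsert i v, tprod_eq_pairInsert i w, localOp_pairInsert,
    formGt_pairInsert_apply, h _ _]

theorem rev_posL (i : Fin (n - 1)) : (posL i).rev = posR i.rev := by
  ext
  simp only [posL, posR, Fin.val_rev]
  omega

theorem rev_posR (i : Fin (n - 1)) : (posR i).rev = posL i.rev := by
  rw [Fin.rev_eq_iff, rev_posL, Fin.rev_rev]

theorem reindex_revPerm_pairInsert (i : Fin (n - 1)) (w : Fin n → W) (t : W ⊗[k] W) :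
    PiTensorProduct.reindex k (fun _ => W) Fin.revPerm (pairInsert i w t) =
      pairInsert i.rev (w ∘ Fin.revPerm) (TensorProduct.comm k W W t) := by
  suffices h : (PiTensorProduct.reindex k (fun _ => W) Fin.revPerm).toLinearMap ∘ₗ pairInsert i w =
      pairInsert i.rev (w ∘ Fin.revPerm) ∘ₗ (TensorProduct.comm k W W).toLinearMap from
    LinearMap.congr_fun h t
  ext a b
  have update_rev : Function.update (Function.update w (posL i) a) (posR i) b ∘ Fin.revPerm =
      Function.update (Function.update (w ∘ Fin.revPerm) (posL i.rev) b) (posR i.rev) a := by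
    rw [Function.update_comp_equiv, Function.update_comp_equiv, Fin.revPerm_symm,
      Fin.revPerm_apply, Fin.revPerm_apply, rev_posL, rev_posR,
      Function.update_comm (posL_lt_posR _).ne]
  simpa [pairInsert_tmul, PiTensorProduct.reindex_tprod, Function.comp_def] using
    congrArg (PiTensorProduct.tprod k) update_rev

theorem reindex_revPerm_localOp (g : W ⊗[k] W →ₗ[k] W ⊗[k] W) (i : Fin (n - 1)) (z : ⨂[k]^n W) :
    PiTensorProduct.reindex k (fun _ => W) Fin.revPerm (localOp g i z) =
      localOp ((TensorProduct.comm k W W).toLinearMap ∘ₗ g ∘ₗ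
        (TensorProduct.comm k W W).toLinearMap) i.rev
        (PiTensorProduct.reindex k (fun _ => W) Fin.revPerm z) := by
  suffices h : (PiTensorProduct.reindex k (fun _ => W) Fin.revPerm).toLinearMap ∘ₗ localOp g i =
      localOp ((TensorProduct.comm k W W).toLinearMap ∘ₗ g ∘ₗ
        (TensorProduct.comm k W W).toLinearMap) i.rev ∘ₗ
        (PiTensorProduct.reindex k (fun _ => W) Fin.revPerm).toLinearMap from
    LinearMap.congr_fun h z
  ext w
  simp only [LinearMap.compMultilinearMap_apply, LinearMap.comp_apply, LinearEquiv.coe_coe,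
    tprod_eq_pairInsert i w, localOp_pairInsert, reindex_revPerm_pairInsert]
  simp

variable {cV : Braiding k V} {cW : Braiding k W}

theorem CaseA.isAdjointFor_localOp (h : CaseA cV cW β) (i : Fin (n - 1)) :
    IsAdjointFor (formGt β n) (localOp cV.c.toLinearMap i) (localOp cW.c.toLinearMap i) :=
  BraidedHopf.isAdjointFor_localOp h i

theorem CaseB.isAdjointFor_localOp (h : CaseB cV cW β) (i : Fin (n - 1)) :
    IsAdjointFor (formLt β n) (localOp cV.c.toLinearMap i) (localOp cW.c.toLinearMap i.rev) := by
  intro u z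
  simp only [formLt, LinearMap.compl₂_apply, LinearEquiv.coe_coe, reindex_revPerm_localOp,
    Fin.rev_rev]
  refine BraidedHopf.isAdjointFor_localOp (fun x y => ?_) i u _
  simpa using h x (TensorProduct.comm k W W y)

end LocalAdjoints

section SymmetrizerAdjoints

variable {n : ℕ} {ρ : Equiv.Perm (Fin (n - 1))} {κ : Equiv.Perm (Fin n) ≃* Equiv.Perm (Fin n)}

theorem IsReducedWord.map (hκ : ∀ i, κ (tau i) = tau (ρ i)) {l : List (Fin (n - 1))}
    {x : Equiv.Perm (Fin n)} (hl : IsReducedWord l x) : IsReducedWord (l.map ρ) (κ x) := by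
  have prod_map (m : List (Fin (n - 1))) : ((m.map ρ).map tau).prod = κ (m.map tau).prod := by
    simp only [map_list_prod, List.map_map, Function.comp_def, hκ]
  obtain ⟨rfl, hmin⟩ := hl
  refine ⟨prod_map l, fun m hm => ?_⟩
  have : ((m.map ρ.symm).map tau).prod = (l.map tau).prod :=
    κ.injective (by rw [← prod_map, ← hm]; simp)
  simpa using hmin _ this

variable {k V W : Type*} [Field k] [AddCommGroup V] [Module k V] [AddCommGroup W] [Module k W]
  {cV : Braiding k V} {cW : Braiding k W} {f : ⨂[k]^n V →ₗ[k] ⨂[k]^n W →ₗ[k] k}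

theorem isAdjointFor_action_word
    (hf : ∀ i, IsAdjointFor f (localOp cV.c.toLinearMap i) (localOp cW.c.toLinearMap (ρ i)))
    (l : List (Fin (n - 1))) :
    IsAdjointFor f (cV.action n (l.map sigma).prod).toLinearMap
      (cW.action n ((l.map ρ).reverse.map sigma).prod).toLinearMap := by
  induction l with
  | nil => exact fun u z => by simp
  | cons i l ih =>
    intro u z
    simpa [cV.action_sigma, cW.action_sigma, -List.map_reverse] using ((hf i).mul ih) u z

theorem isAdjointFor_action_braidSection (hκ : ∀ i, κ (tau i) = tau (ρ i))
    (hf : ∀ i, IsAdjointFor f (localOp cV.c.toLinearMap i) (localOp cW.c.toLinearMap (ρ i)))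
    (x : Equiv.Perm (Fin n)) :
    IsAdjointFor f (cV.action n (braidSection x)).toLinearMap
      (cW.action n (braidSection (κ x)⁻¹)).toLinearMap := by
  obtain ⟨l, hl⟩ := exists_isReducedWord x
  rw [braidSection_eq hl, braidSection_eq (hl.map hκ).reverse]
  exact isAdjointFor_action_word hf l

theorem Braiding.sym_eq_sum (c : Braiding k V) (n : ℕ) :
    c.sym n = ∑ x : Equiv.Perm (Fin n), (c.action n (braidSection x)).toLinearMap :=
  LinearMap.ext fun t => by simp [c.sym_apply, LinearMap.sum_apply]

theorem isAdjointFor_sym (hκ : ∀ i, κ (tau i) = tau (ρ i))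
    (hf : ∀ i, IsAdjointFor f (localOp cV.c.toLinearMap i) (localOp cW.c.toLinearMap (ρ i))) :
    IsAdjointFor f (cV.sym n) (cW.sym n) := by
  have reindexed : cW.sym n =
      ∑ x : Equiv.Perm (Fin n), (cW.action n (braidSection (κ x)⁻¹)).toLinearMap := by
    rw [cW.sym_eq_sum]
    exact (Equiv.sum_comp (κ.toEquiv.trans (Equiv.inv _)) fun x =>
      (cW.action n (braidSection x)).toLinearMap).symm
  rw [cV.sym_eq_sum, reindexed]
  exact .sum fun x _ => isAdjointFor_action_braidSection hκ hf x

variable {β : V →ₗ[k] W →ₗ[k] k}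

theorem CaseA.isAdjointFor_sym (h : CaseA cV cW β) (n : ℕ) :
    IsAdjointFor (formGt β n) (cV.sym n) (cW.sym n) :=
  BraidedHopf.isAdjointFor_sym (ρ := 1) (κ := MulEquiv.refl _) (fun _ => rfl)
    h.isAdjointFor_localOp

theorem CaseB.isAdjointFor_sym (h : CaseB cV cW β) (n : ℕ) :
    IsAdjointFor (formLt β n) (cV.sym n) (cW.sym n) := by
  refine BraidedHopf.isAdjointFor_sym (ρ := Fin.revPerm) (κ := MulAut.conj Fin.revPerm)
    (fun i => ?_) h.isAdjointFor_localOp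
  rw [MulAut.conj_apply, tau, Equiv.mul_swap_eq_swap_mul, mul_inv_cancel_right, Fin.revPerm_apply,
    Fin.revPerm_apply, rev_posL, rev_posR, Equiv.swap_comm]
  rfl

end SymmetrizerAdjoints

section GradedForm

variable {ι R P : Type*} [DecidableEq ι] [CommRing R] [AddCommGroup P] [Module R P]
  {M N : ι → Type*} [∀ i, AddCommGroup (M i)] [∀ i, Module R (M i)] [∀ i, AddCommGroup (N i)]
  [∀ i, Module R (N i)]

/-- The orthogonal direct sum of a family of pairings: `f i` on the components of degree `i`, and
zero on components of different degrees. -/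
noncomputable def gradedForm (f : ∀ i, M i →ₗ[R] N i →ₗ[R] P) :
    (⨁ i, M i) →ₗ[R] (⨁ i, N i) →ₗ[R] P :=
  DirectSum.toModule R ι _ fun i => (f i).compl₂ (DirectSum.component R ι N i)

variable (f : ∀ i, M i →ₗ[R] N i →ₗ[R] P)

theorem gradedForm_lof_left (i : ι) (x : M i) (y : ⨁ i, N i) :
    gradedForm f (DirectSum.lof R ι M i x) y = f i x (y i) := by
  rw [gradedForm, DirectSum.toModule_lof]
  rfl

theorem gradedForm_flip : (gradedForm f).flip = gradedForm fun i => (f i).flip := by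
  ext j y i x
  simp only [LinearMap.comp_apply, LinearMap.flip_apply, gradedForm_lof_left]
  by_cases h : i = j
  · subst h
    simp [DirectSum.lof_apply]
  · simp [DirectSum.lof_eq_of, DirectSum.of_eq_of_ne, h, Ne.symm h]

theorem gradedForm_lof_right (x : ⨁ i, M i) (i : ι) (y : N i) :
    gradedForm f x (DirectSum.lof R ι N i y) = f i (x i) y := by
  rw [← LinearMap.flip_apply, gradedForm_flip, gradedForm_lof_left, LinearMap.flip_apply]

theorem gradedForm_separatingLeft (hf : ∀ i, (f i).SeparatingLeft) :
    (gradedForm f).SeparatingLeft := fun x hx =>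
  DFinsupp.ext fun i => hf i _ fun y => by
    rw [← gradedForm_lof_right, hx]

theorem gradedForm_comp_lmap {M' : ι → Type*} [∀ i, AddCommGroup (M' i)] [∀ i, Module R (M' i)]
    (g : ∀ i, M' i →ₗ[R] M i) :
    gradedForm (fun i => f i ∘ₗ g i) = gradedForm f ∘ₗ DirectSum.lmap g :=
  DirectSum.linearMap_ext _ fun i => LinearMap.ext₂ fun x y => by
    simp only [LinearMap.comp_apply, gradedForm_lof_left, DirectSum.lmap_lof]

end GradedForm

section TotalForm

variable {k V W : Type*} [Field k] [AddCommGroup V] [Module k V] [AddCommGroup W] [Module k W]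
  {cV : Braiding k V} {cW : Braiding k W} {f : ∀ n : ℕ, ⨂[k]^n V →ₗ[k] ⨂[k]^n W →ₗ[k] k}

theorem totalForm_eq_gradedForm_comp : totalForm cV f = gradedForm f ∘ₗ cV.symTotal :=
  gradedForm_comp_lmap f cV.sym

theorem ker_totalForm (hf : ∀ n, (f n).SeparatingLeft) :
    LinearMap.ker (totalForm cV f) = LinearMap.ker cV.symTotal := by
  rw [totalForm_eq_gradedForm_comp, LinearMap.ker_comp,
    LinearMap.separatingLeft_iff_ker_eq_bot.1 (gradedForm_separatingLeft f hf), Submodule.comap_bot]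

theorem totalForm_flip (hf : ∀ n, IsAdjointFor (f n) (cV.sym n) (cW.sym n)) :
    (totalForm cV f).flip = totalForm cW fun n => (f n).flip := by
  refine (gradedForm_flip _).trans (congrArg gradedForm (funext fun n => ?_))
  exact LinearMap.ext₂ fun z u => hf n u z

end TotalForm

section Deconcatenation

variable {k V W : Type*} [Field k] [AddCommGroup V] [Module k V] [AddCommGroup W] [Module k W]

theorem regrade_of_ne {n m : ℕ} (h : n ≠ m) : regrade k V n m = 0 := by
  rw [regrade, DirectSum.component_comp_lof, dif_neg h]

theorem map_component_deconcat (p q : ℕ) (u : TensorAlg k V) :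
    TensorProduct.map (DirectSum.component k ℕ (fun n => ⨂[k]^n V) p)
      (DirectSum.component k ℕ (fun n => ⨂[k]^n V) q) (deconcat k V u) =
      TensorPower.mulEquiv.symm (u (p + q)) := by
  suffices h : TensorProduct.map (DirectSum.component k ℕ (fun n => ⨂[k]^n V) p)
      (DirectSum.component k ℕ (fun n => ⨂[k]^n V) q) ∘ₗ deconcat k V =
      TensorPower.mulEquiv.symm.toLinearMap ∘ₗ DirectSum.component k ℕ (fun n => ⨂[k]^n V) (p + q)
    from LinearMap.congr_fun h u
  refine DirectSum.linearMap_ext _ fun n => ?_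
  have hsum : (TensorProduct.map (DirectSum.component k ℕ (fun n => ⨂[k]^n V) p)
      (DirectSum.component k ℕ (fun n => ⨂[k]^n V) q) ∘ₗ deconcat k V) ∘ₗ incl k V n =
      ∑ a ∈ Finset.HasAntidiagonal.antidiagonal n,
        TensorProduct.map (regrade k V a.1 p) (regrade k V a.2 q) ∘ₗ
          TensorPower.mulEquiv.symm.toLinearMap ∘ₗ regrade k V n (a.1 + a.2) := by
    refine LinearMap.ext fun t => ?_
    simp only [LinearMap.comp_apply, deconcat, DirectSum.toModule_lof, LinearMap.sum_apply, map_sum,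
      regrade, TensorProduct.map_comp]
  rw [hsum, Finset.sum_eq_single (p, q)]
  · refine LinearMap.ext fun t => ?_
    have hid (m : ℕ) : regrade k V m m = LinearMap.id := LinearMap.ext (regrade_self m)
    rw [hid, hid, TensorProduct.map_id]
    rfl
  · intro a _ ha
    rcases not_and_or.1 fun h => ha (Prod.ext_iff.2 h) with h | h <;>
      simp [regrade_of_ne h]
  · intro h
    rw [regrade_of_ne fun h' => h (Finset.HasAntidiagonal.mem_antidiagonal.2 h'.symm)]
    simp

theorem tensorSquare_gradedForm_incl (f : ∀ n : ℕ, ⨂[k]^n V →ₗ[k] ⨂[k]^n W →ₗ[k] k)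
    (s : TensorAlg k V ⊗[k] TensorAlg k V) {p q : ℕ} (z : ⨂[k]^p W) (z' : ⨂[k]^q W) :
    tensorSquare (gradedForm f) s (incl k W p z ⊗ₜ incl k W q z') =
      TensorProduct.dualDistrib k _ _ (TensorProduct.map (f p) (f q) (TensorProduct.map
        (DirectSum.component k ℕ (fun n => ⨂[k]^n V) p)
        (DirectSum.component k ℕ (fun n => ⨂[k]^n V) q) s)) (z ⊗ₜ z') := by
  induction s with
  | zero => simp
  | add s s' hs hs' => simp only [map_add, LinearMap.add_apply, hs, hs']
  | tmul x y =>
    rw [tensorSquare_tmul, gradedForm_lof_right, gradedForm_lof_right]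
    rfl

theorem gradedForm_incl_add (f : ∀ n : ℕ, ⨂[k]^n V →ₗ[k] ⨂[k]^n W →ₗ[k] k) {p q : ℕ}
    {z : ⨂[k]^p W} {z' : ⨂[k]^q W} {t : ⨂[k]^(p + q) W}
    (ht : ∀ x y, f (p + q) (TensorPower.mulEquiv (x ⊗ₜ y)) t = f p x z * f q y z')
    (u : TensorAlg k V) :
    gradedForm f u (incl k W (p + q) t) =
      tensorSquare (gradedForm f) (deconcat k V u) (incl k W p z ⊗ₜ incl k W q z') := by
  rw [gradedForm_lof_right, tensorSquare_gradedForm_incl, map_component_deconcat]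
  obtain ⟨s, hs⟩ := TensorPower.mulEquiv.surjective (u (p + q))
  rw [← hs, LinearEquiv.symm_apply_apply]
  clear hs
  induction s with
  | zero => simp
  | add s s' hs hs' => simp only [map_add, LinearMap.add_apply, hs, hs']
  | tmul x y => exact ht x y

theorem incl_cast {m n : ℕ} (h : m = n) (t : ⨂[k]^m W) :
    incl k W n (TensorPower.cast k W h t) = incl k W m t := by
  subst h
  rw [TensorPower.cast_refl, LinearEquiv.refl_apply]

theorem gradedForm_formGt_mul (β : V →ₗ[k] W →ₗ[k] k) (u : TensorAlg k V) (z z' : TensorAlg k W) :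
    gradedForm (formGt β) u (z * z') =
      tensorSquare (gradedForm (formGt β)) (deconcat k V u) (z ⊗ₜ z') := by
  suffices h : (LinearMap.mul k (TensorAlg k W)).compr₂ (gradedForm (formGt β) u) =
      TensorProduct.curry (tensorSquare (gradedForm (formGt β)) (deconcat k V u))
    from LinearMap.congr_fun₂ h z z'
  refine DirectSum.linearMap_ext _ fun p => LinearMap.ext fun z =>
    DirectSum.linearMap_ext _ fun q => LinearMap.ext fun z' => ?_
  change gradedForm (formGt β) u (incl k W p z * incl k W q z') = _
  rw [incl_mul_incl]
  exact gradedForm_incl_add _ (fun x y => formGt_mulEquiv β x y z z') u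

theorem gradedForm_formLt_mul (β : V →ₗ[k] W →ₗ[k] k) (u : TensorAlg k V) (z z' : TensorAlg k W) :
    gradedForm (formLt β) u (z * z') =
      tensorSquare (gradedForm (formLt β)) (deconcat k V u) (z' ⊗ₜ z) := by
  suffices h : (LinearMap.mul k (TensorAlg k W)).compr₂ (gradedForm (formLt β) u) =
      (TensorProduct.curry (tensorSquare (gradedForm (formLt β)) (deconcat k V u))).flip
    from LinearMap.congr_fun₂ h z z'
  refine DirectSum.linearMap_ext _ fun p => LinearMap.ext fun z =>
    DirectSum.linearMap_ext _ fun q => LinearMap.ext fun z' => ?_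
  change gradedForm (formLt β) u (incl k W p z * incl k W q z') = _
  rw [incl_mul_incl, ← incl_cast (add_comm p q)]
  exact gradedForm_incl_add _ (fun x y => formLt_mulEquiv β x y z' z) u

end Deconcatenation

section TensorSquare

variable {k V V' W W' : Type*} [Field k] [AddCommGroup V] [Module k V] [AddCommGroup V']
  [Module k V'] [AddCommGroup W] [Module k W] [AddCommGroup W'] [Module k W']

theorem tensorSquare_compl₁₂ (β : V' →ₗ[k] W' →ₗ[k] k) (a : V →ₗ[k] V') (b : W →ₗ[k] W') :
    tensorSquare (β.compl₁₂ a b) =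
      (tensorSquare β).compl₁₂ (TensorProduct.map a a) (TensorProduct.map b b) := by
  ext x x' y y'
  simp [tensorSquare_tmul]

theorem tensorSquare_flip (β : V →ₗ[k] W →ₗ[k] k) :
    tensorSquare β.flip = (tensorSquare β).flip := by
  ext y y' x x'
  simp [tensorSquare_tmul]

theorem tensorSquare_apply_tmul (β : V →ₗ[k] W →ₗ[k] k) (s : V ⊗[k] V) (y y' : W) :
    tensorSquare β s (y ⊗ₜ y') =
      LinearMap.mul' k k (TensorProduct.map (β.flip y) (β.flip y') s) := by
  suffices h : (tensorSquare β).flip (y ⊗ₜ y') =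
      LinearMap.mul' k k ∘ₗ TensorProduct.map (β.flip y) (β.flip y')
    from LinearMap.congr_fun h s
  ext x x'
  simp [tensorSquare_tmul]

end TensorSquare

section Generation

variable {k V : Type*} [Field k] [AddCommGroup V] [Module k V] (c : Braiding k V)

theorem Braiding.deg1_apply (v : V) :
    c.deg1 v = c.proj (incl k V 1 (PiTensorProduct.tprod k fun _ => v)) := by
  simp only [Braiding.deg1, LinearMap.comp_apply, LinearEquiv.coe_coe,
    PiTensorProduct.subsingletonEquiv_symm_apply']
  rfl

theorem Braiding.adjoin_range_deg1 : Algebra.adjoin k (Set.range c.deg1) = ⊤ := by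
  let φ : TensorAlgebra k V →ₐ[k] c.Toba := c.proj.comp TensorAlgebra.equivDirectSum.toAlgHom
  have hφ : Function.Surjective φ := c.proj_surjective.comp TensorAlgebra.equivDirectSum.surjective
  have deg1_eq : ⇑c.deg1 = φ ∘ TensorAlgebra.ι k := funext fun v =>
    (c.deg1_apply v).trans (congrArg c.proj (TensorAlgebra.toDirectSum_ι v).symm)
  rw [deg1_eq, Set.range_comp, ← AlgHom.map_adjoin, TensorAlgebra.adjoin_range_ι, Algebra.map_top,
    (AlgHom.range_eq_top φ).2 hφ]

theorem Braiding.iSup_degree : ⨆ n, c.degree n = ⊤ := by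
  have hincl : ⨆ n, LinearMap.range (incl k V n) = ⊤ := DFinsupp.iSup_range_lsingle
  simp only [Braiding.degree, LinearMap.range_comp, ← Submodule.map_iSup, hincl, Submodule.map_top]
  exact LinearMap.range_eq_top.2 c.proj_surjective

theorem Braiding.degree_zero : c.degree 0 = Submodule.span k {1} := by
  have htop : Submodule.span k {PiTensorProduct.tprod k Fin.elim0} =
      (⊤ : Submodule k (⨂[k]^0 V)) := by
    rw [← PiTensorProduct.span_tprod_eq_top, Set.range_unique, Subsingleton.elim default]
  rw [Braiding.degree, LinearMap.range_eq_map, ← htop, Submodule.map_span, Set.image_singleton]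
  exact congrArg (fun x => Submodule.span k {x}) (map_one c.proj)

theorem Braiding.degree_one : c.degree 1 = LinearMap.range c.deg1 := by
  rw [Braiding.degree, Braiding.deg1, ← LinearMap.comp_assoc, LinearEquiv.range_comp]

end Generation

section Uniqueness

variable {k V W : Type*} [Field k] [AddCommGroup V] [Module k V] [AddCommGroup W] [Module k W]
  {cV : Braiding k V} {cW : Braiding k W} {β : V →ₗ[k] W →ₗ[k] k}
  {P P' : cV.Toba →ₗ[k] cW.Toba →ₗ[k] k}

theorem IsGradedPairing.flip_eq_of_mem_degree (hP : IsGradedPairing cV cW β P)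
    (hP' : IsGradedPairing cV cW β P') {j : ℕ} {z : cW.Toba} (hz : z ∈ cW.degree j)
    (h : ∀ u ∈ cV.degree j, P u z = P' u z) : P.flip z = P'.flip z := by
  refine LinearMap.ext fun u => ?_
  have hu : u ∈ ⨆ n, cV.degree n := cV.iSup_degree ▸ Submodule.mem_top
  induction hu using Submodule.iSup_induction' with
  | zero => simp only [map_zero]
  | add u u' _ _ hu hu' => simp only [map_add, hu, hu']
  | mem i u hu =>
    rw [LinearMap.flip_apply, LinearMap.flip_apply]
    obtain rfl | hij := eq_or_ne i j
    · exact h u hu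
    · rw [hP.graded i j hij u hu z hz, hP'.graded i j hij u hu z hz]

theorem IsGradedPairing.ext_of_mul (hP : IsGradedPairing cV cW β P)
    (hP' : IsGradedPairing cV cW β P')
    (mul : ∀ z z', P.flip z = P'.flip z → P.flip z' = P'.flip z' →
      P.flip (z * z') = P'.flip (z * z')) : P = P' := by
  suffices h : P.flip = P'.flip from congrArg LinearMap.flip h
  refine LinearMap.ext fun z => ?_
  have hz : z ∈ Algebra.adjoin k (Set.range cW.deg1) := cW.adjoin_range_deg1 ▸ Algebra.mem_top
  induction hz using Algebra.adjoin_induction with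
  | add z z' _ _ hz hz' => rw [map_add, map_add, hz, hz']
  | mul z z' _ _ hz hz' => exact mul z z' hz hz'
  | algebraMap r =>
    rw [Algebra.algebraMap_eq_smul_one, map_smul, map_smul]
    congr 1
    refine hP.flip_eq_of_mem_degree hP' (cW.degree_zero ▸ Submodule.mem_span_singleton_self 1) ?_
    simp only [cV.degree_zero, Submodule.mem_span_singleton]
    rintro _ ⟨s, rfl⟩
    simp only [map_smul, LinearMap.smul_apply, hP.one_one, hP'.one_one]
  | mem z hz =>
    obtain ⟨w, rfl⟩ := hz
    refine hP.flip_eq_of_mem_degree hP' (cW.degree_one ▸ LinearMap.mem_range_self _ w) ?_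
    rw [cV.degree_one]
    rintro _ ⟨v, rfl⟩
    rw [hP.deg_one, hP'.deg_one]

theorem IsPairingA.unique (hP : IsPairingA cV cW β P) (hP' : IsPairingA cV cW β P') : P = P' :=
  hP.toIsGradedPairing.ext_of_mul hP'.toIsGradedPairing fun z z' hz hz' => LinearMap.ext fun u => by
    simp only [LinearMap.flip_apply, hP.apply_mul, hP'.apply_mul, tensorSquare_apply_tmul, hz, hz']

theorem IsPairingB.unique (hP : IsPairingB cV cW β P) (hP' : IsPairingB cV cW β P') : P = P' :=
  hP.toIsGradedPairing.ext_of_mul hP'.toIsGradedPairing fun z z' hz hz' => LinearMap.ext fun u => by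
    simp only [LinearMap.flip_apply, hP.apply_mul, hP'.apply_mul, tensorSquare_apply_tmul, hz, hz']

end Uniqueness

section Existence

variable {k V W : Type*} [Field k] [AddCommGroup V] [Module k V] [AddCommGroup W] [Module k W]
  {cV : Braiding k V} {cW : Braiding k W} {β : V →ₗ[k] W →ₗ[k] k}
  {f : ∀ n : ℕ, ⨂[k]^n V →ₗ[k] ⨂[k]^n W →ₗ[k] k} {P : cV.Toba →ₗ[k] cW.Toba →ₗ[k] k}

theorem Braiding.sym_of_subsingleton (c : Braiding k V) {n : ℕ} [Subsingleton (Fin n)] :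
    c.sym n = LinearMap.id := by
  refine LinearMap.ext fun t => ?_
  rw [c.sym_apply, Fintype.sum_subsingleton _ (1 : Equiv.Perm (Fin n)), braidSection_one, map_one]
  rfl

theorem Braiding.ker_proj (c : Braiding k V) :
    LinearMap.ker c.proj.toLinearMap = LinearMap.ker c.symTotal :=
  Submodule.ext c.proj_eq_zero_iff

theorem isGradedPairing_of_totalForm
    (h0 : f 0 (PiTensorProduct.tprod k Fin.elim0) (PiTensorProduct.tprod k Fin.elim0) = 1)
    (h1 : ∀ v w, f 1 (PiTensorProduct.tprod k fun _ => v) (PiTensorProduct.tprod k fun _ => w) =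
      β v w)
    (hP : P.Nondegenerate) (hT : ∀ u z, P (cV.proj u) (cW.proj z) = totalForm cV f u z) :
    IsGradedPairing cV cW β P where
  nondegenerate := hP
  one_one := by
    rw [← map_one cV.proj, ← map_one cW.proj, hT]
    exact (totalForm_same cV f 0 _ _).trans (by rw [cV.sym_of_subsingleton]; exact h0)
  graded := by
    rintro i j hij _ ⟨u, rfl⟩ _ ⟨z, rfl⟩
    exact (hT _ _).trans (totalForm_of_ne cV f hij u z)
  deg_one v w := by
    rw [cV.deg1_apply, cW.deg1_apply, hT, totalForm_same, cV.sym_of_subsingleton,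
      LinearMap.id_apply, h1]

theorem tensorSquare_tobaComul (hT : ∀ u z, P (cV.proj u) (cW.proj z) = totalForm cV f u z)
    (u : TensorAlg k V) (z z' : TensorAlg k W) :
    tensorSquare P (cV.tobaComul (cV.proj u)) (cW.proj z ⊗ₜ cW.proj z') =
      tensorSquare (gradedForm f) (deconcat k V (cV.symTotal u)) (z ⊗ₜ z') := by
  have pullback_eq : P.compl₁₂ cV.proj.toLinearMap cW.proj.toLinearMap =
      (gradedForm f).compl₁₂ cV.symTotal LinearMap.id :=
    LinearMap.ext₂ fun u z => (hT u z).trans (by rw [totalForm_eq_gradedForm_comp]; rfl)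
  have square_eq := congrArg tensorSquare pullback_eq
  rw [tensorSquare_compl₁₂, tensorSquare_compl₁₂] at square_eq
  rw [cV.tobaComul_proj, cV.deconcat_symTotal]
  simpa using LinearMap.congr_fun₂ square_eq (cV.comul u) (z ⊗ₜ z')

theorem apply_mul_of_totalForm (hT : ∀ u z, P (cV.proj u) (cW.proj z) = totalForm cV f u z)
    {t z z' : TensorAlg k W}
    (hf : ∀ u, gradedForm f u t = tensorSquare (gradedForm f) (deconcat k V u) (z ⊗ₜ z'))
    (u : cV.Toba) :
    P u (cW.proj t) = tensorSquare P (cV.tobaComul u) (cW.proj z ⊗ₜ cW.proj z') := by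
  obtain ⟨u, rfl⟩ := cV.proj_surjective u
  rw [tensorSquare_tobaComul hT, hT, totalForm_eq_gradedForm_comp, LinearMap.comp_apply, hf]

theorem apply_mul_of_totalForm_formGt
    (hT : ∀ u z, P (cV.proj u) (cW.proj z) = totalForm cV (formGt β) u z)
    (u : cV.Toba) (z z' : cW.Toba) :
    P u (z * z') = tensorSquare P (cV.tobaComul u) (z ⊗ₜ z') := by
  obtain ⟨z, rfl⟩ := cW.proj_surjective z
  obtain ⟨z', rfl⟩ := cW.proj_surjective z'
  rw [← map_mul]
  exact apply_mul_of_totalForm hT (fun u => gradedForm_formGt_mul β u z z') u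

theorem apply_mul_of_totalForm_formLt
    (hT : ∀ u z, P (cV.proj u) (cW.proj z) = totalForm cV (formLt β) u z)
    (u : cV.Toba) (z z' : cW.Toba) :
    P u (z * z') = tensorSquare P (cV.tobaComul u) (z' ⊗ₜ z) := by
  obtain ⟨z, rfl⟩ := cW.proj_surjective z
  obtain ⟨z', rfl⟩ := cW.proj_surjective z'
  rw [← map_mul]
  exact apply_mul_of_totalForm hT (fun u => gradedForm_formLt_mul β u z z') u

theorem CaseA.totalForm_flip (h : CaseA cV cW β) :
    (totalForm cV (formGt β)).flip = totalForm cW (formGt β.flip) :=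
  (BraidedHopf.totalForm_flip h.isAdjointFor_sym).trans
    (congrArg (totalForm cW) (funext (formGt_flip β)))

theorem CaseB.totalForm_flip (h : CaseB cV cW β) :
    (totalForm cV (formLt β)).flip = totalForm cW (formLt β.flip) :=
  (BraidedHopf.totalForm_flip h.isAdjointFor_sym).trans
    (congrArg (totalForm cW) (funext (formLt_flip β)))

theorem CaseA.isPairingA (h : CaseA cV cW β) (hP : P.Nondegenerate)
    (hT : ∀ u z, P (cV.proj u) (cW.proj z) = totalForm cV (formGt β) u z) :
    IsPairingA cV cW β P where
  toIsGradedPairing := isGradedPairing_of_totalForm (by simp [formGt_tprod])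
    (by simp [formGt_tprod]) hP hT
  apply_mul := apply_mul_of_totalForm_formGt hT
  mul_apply u u' z := by
    have hT_flip (z u) : P.flip (cW.proj z) (cV.proj u) = totalForm cW (formGt β.flip) z u := by
      rw [← h.totalForm_flip]
      exact hT u z
    rw [← LinearMap.flip_apply, apply_mul_of_totalForm_formGt hT_flip, tensorSquare_flip,
      LinearMap.flip_apply]

theorem CaseB.isPairingB (h : CaseB cV cW β) (hP : P.Nondegenerate)
    (hT : ∀ u z, P (cV.proj u) (cW.proj z) = totalForm cV (formLt β) u z) :
    IsPairingB cV cW β P where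
  toIsGradedPairing := isGradedPairing_of_totalForm (by simp [formLt_tprod])
    (by simp [formLt_tprod]) hP hT
  apply_mul := apply_mul_of_totalForm_formLt hT
  mul_apply u u' z := by
    have hT_flip (z u) : P.flip (cW.proj z) (cV.proj u) = totalForm cW (formLt β.flip) z u := by
      rw [← h.totalForm_flip]
      exact hT u z
    rw [← LinearMap.flip_apply, apply_mul_of_totalForm_formLt hT_flip, tensorSquare_flip,
      LinearMap.flip_apply]

theorem CaseA.ker_totalForm_flip (h : CaseA cV cW β) (hβ : β.SeparatingRight) :
    LinearMap.ker (totalForm cV (formGt β)).flip = LinearMap.ker cW.symTotal := by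
  rw [h.totalForm_flip]
  exact ker_totalForm (formGt_separatingLeft (LinearMap.flip_separatingLeft.2 hβ))

theorem CaseB.ker_totalForm_flip (h : CaseB cV cW β) (hβ : β.SeparatingRight) :
    LinearMap.ker (totalForm cV (formLt β)).flip = LinearMap.ker cW.symTotal := by
  rw [h.totalForm_flip]
  exact ker_totalForm (formLt_separatingLeft (LinearMap.flip_separatingLeft.2 hβ))

theorem exists_nondegenerate_pairing
    (hl : LinearMap.ker (totalForm cV f) = LinearMap.ker cV.symTotal)
    (hr : LinearMap.ker (totalForm cV f).flip = LinearMap.ker cW.symTotal) :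
    ∃ P : cV.Toba →ₗ[k] cW.Toba →ₗ[k] k, P.Nondegenerate ∧
      ∀ u z, P (cV.proj u) (cW.proj z) = totalForm cV f u z :=
  exists_nondegenerate_descent (π := cV.proj.toLinearMap) (π' := cW.proj.toLinearMap)
    cV.proj_surjective cW.proj_surjective (hl.trans cV.ker_proj.symm) (hr.trans cW.ker_proj.symm)

end Existence

end BraidedHopf

theorem mainTheorem6 {k V W : Type*} [Field k] [AddCommGroup V] [Module k V] [AddCommGroup W]
    [Module k W] (cV : BraidedHopf.Braiding k V) (cW : BraidedHopf.Braiding k W)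
    (β : V →ₗ[k] W →ₗ[k] k) (hβ : β.Nondegenerate) :
    (BraidedHopf.CaseA cV cW β →
      (∃! P : cV.Toba →ₗ[k] cW.Toba →ₗ[k] k, BraidedHopf.IsPairingA cV cW β P) ∧
      (∀ P : cV.Toba →ₗ[k] cW.Toba →ₗ[k] k, BraidedHopf.IsPairingA cV cW β P →
        ∀ (u : BraidedHopf.TensorAlg k V) (z : BraidedHopf.TensorAlg k W),
          P (cV.proj u) (cW.proj z) =
            BraidedHopf.totalForm cV (BraidedHopf.formGt β) u z) ∧
      LinearMap.ker (BraidedHopf.totalForm cV (BraidedHopf.formGt β)) =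
        LinearMap.ker cV.symTotal ∧
      LinearMap.ker (BraidedHopf.totalForm cV (BraidedHopf.formGt β)).flip =
        LinearMap.ker cW.symTotal) ∧
    (BraidedHopf.CaseB cV cW β →
      (∃! P : cV.Toba →ₗ[k] cW.Toba →ₗ[k] k, BraidedHopf.IsPairingB cV cW β P) ∧
      (∀ P : cV.Toba →ₗ[k] cW.Toba →ₗ[k] k, BraidedHopf.IsPairingB cV cW β P →
        ∀ (u : BraidedHopf.TensorAlg k V) (z : BraidedHopf.TensorAlg k W),
          P (cV.proj u) (cW.proj z) =
            BraidedHopf.totalForm cV (BraidedHopf.formLt β) u z) ∧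
      LinearMap.ker (BraidedHopf.totalForm cV (BraidedHopf.formLt β)) =
        LinearMap.ker cV.symTotal ∧
      LinearMap.ker (BraidedHopf.totalForm cV (BraidedHopf.formLt β)).flip =
        LinearMap.ker cW.symTotal) := by
  refine ⟨fun h => ?_, fun h => ?_⟩
  · have ker_left := BraidedHopf.ker_totalForm (cV := cV) (BraidedHopf.formGt_separatingLeft hβ.1)
    have ker_right := h.ker_totalForm_flip hβ.2
    obtain ⟨P, hP, hT⟩ := BraidedHopf.exists_nondegenerate_pairing ker_left ker_right
    have hPA := h.isPairingA hP hT
    exact ⟨⟨P, hPA, fun P' hP' => hP'.unique hPA⟩, fun P' hP' => hP'.unique hPA ▸ hT,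
      ker_left, ker_right⟩
  · have ker_left := BraidedHopf.ker_totalForm (cV := cV) (BraidedHopf.formLt_separatingLeft hβ.1)
    have ker_right := h.ker_totalForm_flip hβ.2
    obtain ⟨P, hP, hT⟩ := BraidedHopf.exists_nondegenerate_pairing ker_left ker_right
    have hPB := h.isPairingB hP hT
    exact ⟨⟨P, hPB, fun P' hP' => hP'.unique hPB⟩, fun P' hP' => hP'.unique hPB ▸ hT,
      ker_left, ker_right⟩
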